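/- Let $n \ge 1$ be an integer, let $\langle x\rangle = (1+|x|^2)^{1/2}$ for real numbers and for vectors, and for $m \in \mathbb R$ let $(m^2-\Delta)^{1/2} = \mathfrak F^{-1}(m^2+|\xi|^2)^{1/2}\mathfrak F$ be the Fourier multiplier on $L^2(\mathbb R^n)$ with symbol $(m^2+|\xi|^2)^{1/2}$, where $\mathfrak F u(\xi) = (2\pi)^{-n/2}\int_{\mathbb R^n} u(x)e^{-ix\cdot\xi}\,dx$; the case $m=0$ is $(-\Delta)^{1/2}$. Let $K$ be the integral kernel of the Bessel potential $(1-\Delta)^{-1/2}=\mathfrak F^{-1}(1+|\xi|^2)^{-1/2}\mathfrak F$, that is, a measurable real-valued function on $\mathbb R^n$ such that $(1-\Delta)^{-1/2}\varphi = K * \varphi$ for every Schwartz function $\varphi$ (the convolution being absolutely convergent). Such a $K$ exists, and for every such $K$ the following holds. (i) For every $q > n/2$ one has $\langle\cdot\rangle^{q}K \in L^1(\mathbb R^n)$. For every $q>n/2$ and $m \in \mathbb R$ the function $\langle\cdot\rangle^{-q}$ is in the $L^2$-domain of $(m^2-\Delta)^{1/2}$, the Fourier transform of $(m^2-\Delta)^{1/2}\langle\cdot\rangle^{-q}$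 is in $L^1 \cap L^2$ (so that the pointwise values are those of the continuous representative, given by the absolutely convergent inverse Fourier integral), and for every $x \in \mathbb R^n$ $$|((m^2-\Delta)^{1/2}\langle\cdot\rangle^{-q})(x)| \le |((-\Delta)^{1/2}\langle\cdot\rangle^{-q})(x)| + 2^{q/2}\,\|\langle\cdot\rangle^{q}K\|_{L^1(\mathbb R^n)}\,\langle m\rangle^{q+1}\langle x\rangle^{-q}.$$ (ii) There is a constant $A>0$, depending only on $n$, such that $$|((-\Delta)^{1/2}\langle\cdot\rangle^{-n-1})(x)| \le A\,\langle x\rangle^{-n-1}\qquad\text{for all } x\in\mathbb R^n,$$ and for every real $A$ with this property, every $m\in\mathbb R$, every $R>0$ and every $x\in\mathbb R^n$, the value on the left below being well defined in the same sense as in (i), $$|((m^2-\Delta)^{1/2}\langle\cdot/R\rangle^{-n-1})(x)| \le R^{-1}\,\widetilde A_n\,\langle Rm\rangle^{n+2}\,\langle x/R\rangle^{-n-1},\qquad \widetilde A_n = A + 2^{(n+1)/2}\,\|\langle\cdot\rangle^{n+1}K\|_{L^1(\mathbb R^n)}.$$ -/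

import Mathlib

open MeasureTheory
open scoped FourierTransform SchwartzMap

noncomputable section

namespace MassiveWeight

/-- The space `ℝⁿ` with the Euclidean norm. -/
abbrev Rn (n : ℕ) : Type := EuclideanSpace ℝ (Fin n)

/-- The Japanese bracket `⟨x⟩ = (1 + |x|²)^{1/2}`, for real numbers and for vectors. -/
def jap {V : Type*} [Norm V] (x : V) : ℝ := Real.sqrt (1 + ‖x‖ ^ 2)

/-- The symbol `ξ ↦ (m² + |ξ|²)^{1/2}`. -/
def symb {n : ℕ} (m : ℝ) (ξ : Rn n) : ℝ := Real.sqrt (m ^ 2 + ‖ξ‖ ^ 2)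

open Classical in
/-- The Fourier transform on `L²(ℝⁿ)` (Plancherel), applied to a function `f`; it is only meant
for square-integrable `f` and set to `0` otherwise. Mathlib's normalization is
`𝓕 f ξ = ∫ f(x) e^{-2π i x·ξ} dx`. -/
def fourierL2 {n : ℕ} (f : Rn n → ℂ) : Rn n → ℂ :=
  if h : MemLp f 2 volume then ((𝓕 (h.toLp f) : Lp ℂ 2 (volume : Measure (Rn n))) : Rn n → ℂ)
  else 0

/-- The function `ξ ↦ σ(2πξ) (𝓕 f)(ξ)`. With the normalization `e^{-2π i x·ξ}` the operator with
symbol `σ` in the angular frequency (for which `-Δ` has symbol `|ξ|²`) multiplies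
`(𝓕 f)(ξ)` by `σ(2πξ)`. -/
def multiplied {n : ℕ} (σ : Rn n → ℝ) (f : Rn n → ℂ) : Rn n → ℂ :=
  fun ξ => (σ ((2 * Real.pi) • ξ) : ℂ) * fourierL2 f ξ

/-- The Fourier multiplier `𝓕⁻¹ σ 𝓕 f`, evaluated at the point `x` through the inverse Fourier
integral. For `f` with `MultiplierDefined σ f` this is the continuous representative of the
`L²` function `𝓕⁻¹ (σ 𝓕 f)`. -/
def multiplier {n : ℕ} (σ : Rn n → ℝ) (f : Rn n → ℂ) (x : Rn n) : ℂ :=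
  𝓕⁻ (multiplied σ f) x

/-- `f` is in the `L²`-domain of the multiplier with symbol `σ`, and its image has pointwise
values given by an absolutely convergent inverse Fourier integral. -/
structure MultiplierDefined {n : ℕ} (σ : Rn n → ℝ) (f : Rn n → ℂ) : Prop where
  memLp : MemLp f 2 volume
  memLp_multiplied : MemLp (multiplied σ f) 2 volume
  integrable_multiplied : Integrable (multiplied σ f) volume

/-- `(m² - Δ)^{1/2} f` at the point `x`; the case `m = 0` is `(-Δ)^{1/2} f`. -/
def sqrtOp {n : ℕ} (m : ℝ) (f : Rn n → ℂ) (x : Rn n) : ℂ := multiplier (symb m) f x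

/-- The weight `x ↦ ⟨x/R⟩^{-q}` on `ℝⁿ`. -/
def weight (n : ℕ) (q R : ℝ) : Rn n → ℂ := fun x => ((jap (R⁻¹ • x) ^ (-q) : ℝ) : ℂ)

/-- `K` is an integral kernel of the Bessel potential: a measurable function with
`(1 - Δ)^{-1/2} φ = K ∗ φ` for all Schwartz functions `φ`. -/
structure IsBesselKernel {n : ℕ} (K : Rn n → ℝ) : Prop where
  measurable : Measurable K
  integrable_conv : ∀ (φ : 𝓢(Rn n, ℂ)) (x : Rn n), Integrable (fun y => (K y : ℂ) * φ (x - y))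
  conv_eq : ∀ (φ : 𝓢(Rn n, ℂ)) (x : Rn n),
    multiplier (fun ξ => (symb 1 ξ)⁻¹) φ x = ∫ y, (K y : ℂ) * φ (x - y)

/-- The weighted norm `‖⟨·⟩^q K‖_{L¹(ℝⁿ)}` (for integrable `⟨·⟩^q K`). -/
def weightedNorm {n : ℕ} (q : ℝ) (K : Rn n → ℝ) : ℝ := ∫ y, ‖jap y ^ q * K y‖

/-- `A` is an admissible constant `A_{n,n+1}`: for all `x`,
`|((-Δ)^{1/2} ⟨·⟩^{-n-1})(x)| ≤ A ⟨x⟩^{-n-1}`. -/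
def MasslessBound (n : ℕ) (A : ℝ) : Prop :=
  ∀ x : Rn n, ‖sqrtOp 0 (weight n ((n : ℝ) + 1) 1) x‖ ≤ A * jap x ^ (-((n : ℝ) + 1))

end MassiveWeight

end

namespace MassiveWeight

open ProbabilityTheory Set Real

/-! Let `w = ⟨·⟩^{-q}`. Since `(1 + |x|²)^{-q/2}` is the Laplace transform of a Gamma law of shape
`q/2`, `w` is a positive mixture of Gaussians `exp (-s|x|²)`, and its Fourier transform `gaussMix`
is again a positive mixture of Gaussians. Moments of the Gamma law then decide every integrability
question.

The square root is a superposition of exponentials, `√λ = C⁻¹ ∫₀^∞ (1 - e^{-λt}) t^{-3/2} dt`, so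
`(m² - Δ)^{1/2} w = C⁻¹ ∫ (w - e^{-m²t} e^{tΔ} w) t^{-3/2} dt` (`sqrtOp_weight_eq`). Positivity of
`e^{tΔ} w` shows that this is at least the value for `m = 0`. The pointwise bound `e^{tΔ} w ≥
e^{-qnt} w` (`le_heatMix`) shows that it is at most `√(m² + qn) w`. Hence `|(m² - Δ)^{1/2} w| ≤
|(-Δ)^{1/2} w| + √(m² + qn) w` (`norm_sqrtOp_weight_le`).

The Bessel kernel enters only through a lower bound on its weighted norm. It is itself a Gaussian
mixture with explicit moments, which give `qn ≤ 2^q ‖⟨·⟩^q K‖²`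
(`mul_le_two_rpow_mul_weightedNorm_sq`). Any other kernel agrees with it almost everywhere.

For `q = n + 1`, the symmetry `s ↦ 1/s` turns `|ξ| ŵ(ξ)` into `|ξ|²` times a Gaussian mixture. The
massless operator thus becomes a second-order operator acting on Gaussians, with an explicit
estimate (`masslessBound`). Dilation gives the case of general `R`. -/

/-! ### Integrals and moments of the Gamma distribution -/

theorem gammaMeasure_ae_pos (a r : ℝ) : ∀ᵐ t ∂gammaMeasure a r, 0 < t := by
  unfold gammaMeasure
  rw [ae_withDensity_iff (f := gammaPDF a r) (measurable_gammaPDFReal a r).ennreal_ofReal]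
  have h0 : ∀ᵐ t : ℝ, t ≠ 0 := by simp [ae_iff, measure_singleton]
  filter_upwards [h0] with t ht h
  by_contra hlt
  exact h (gammaPDF_of_neg (lt_of_le_of_ne (not_lt.1 hlt) ht))

theorem gammaPDF_smul_eq_indicator {a r : ℝ} (ha : 0 < a) (hr : 0 < r) (g : ℝ → ℝ) :
    (fun t => (gammaPDF a r t).toReal • g t) =ᵐ[volume]
      (Ioi (0 : ℝ)).indicator
        (fun t => r ^ a / Gamma a * (t ^ (a - 1) * exp (-(r * t)) * g t)) := by
  have h0 : ∀ᵐ t : ℝ, t ≠ 0 := by simp [ae_iff, measure_singleton]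
  filter_upwards [h0] with t ht
  rcases lt_or_gt_of_ne ht with h | h
  · rw [gammaPDF_of_neg h, indicator_of_notMem (by simpa using h.le)]; simp
  · have := Gamma_pos_of_pos ha
    rw [indicator_of_mem (by simpa using h), gammaPDF_of_nonneg h.le,
      ENNReal.toReal_ofReal (by positivity), smul_eq_mul]
    ring

theorem integrable_gammaMeasure_iff {a r : ℝ} (ha : 0 < a) (hr : 0 < r) (g : ℝ → ℝ) :
    Integrable g (gammaMeasure a r) ↔
      IntegrableOn (fun t => t ^ (a - 1) * exp (-(r * t)) * g t) (Ioi 0) := by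
  have := Gamma_pos_of_pos ha
  have hc : r ^ a / Gamma a ≠ 0 := by positivity
  unfold gammaMeasure
  rw [integrable_withDensity_iff_integrable_smul' (f := gammaPDF a r)
    (measurable_gammaPDFReal a r).ennreal_ofReal (by simp [gammaPDF]),
    integrable_congr (gammaPDF_smul_eq_indicator ha hr g),
    integrable_indicator_iff measurableSet_Ioi, IntegrableOn,
    integrable_const_mul_iff (IsUnit.mk0 _ hc), IntegrableOn]

theorem integral_gammaMeasure {a r : ℝ} (ha : 0 < a) (hr : 0 < r) (g : ℝ → ℝ) :
    ∫ t, g t ∂gammaMeasure a r =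
      r ^ a / Gamma a * ∫ t in Ioi 0, t ^ (a - 1) * exp (-(r * t)) * g t := by
  unfold gammaMeasure
  rw [integral_withDensity_eq_integral_toReal_smul (f := gammaPDF a r)
    (measurable_gammaPDFReal a r).ennreal_ofReal (by simp [gammaPDF]),
    integral_congr_ae (gammaPDF_smul_eq_indicator ha hr g),
    integral_indicator measurableSet_Ioi, integral_const_mul]

theorem gammaMeasure_integrand_eq {a r j s t : ℝ} (ht : 0 < t) :
    t ^ (a - 1) * exp (-(r * t)) * (t ^ j * exp (-(s * t))) =
      t ^ (a + j - 1) * exp (-((r + s) * t)) := by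
  rw [show a + j - 1 = (a - 1) + j by ring, rpow_add ht,
    show -((r + s) * t) = -(r * t) + -(s * t) by ring, exp_add]
  ring

theorem integrable_rpow_mul_exp_gammaMeasure {a r j s : ℝ} (ha : 0 < a) (hr : 0 < r)
    (hj : 0 < a + j) (hs : 0 < r + s) :
    Integrable (fun t => t ^ j * exp (-(s * t))) (gammaMeasure a r) := by
  rw [integrable_gammaMeasure_iff ha hr]
  have := integrableOn_rpow_mul_exp_neg_mul_rpow (p := 1) (s := a + j - 1) (b := r + s)
    (by linarith) one_pos hs
  refine this.congr_fun (fun t ht => ?_) measurableSet_Ioi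
  simp only [rpow_one]
  rw [gammaMeasure_integrand_eq ht, neg_mul]

theorem integral_rpow_mul_exp_gammaMeasure {a r j s : ℝ} (ha : 0 < a) (hr : 0 < r)
    (hj : 0 < a + j) (hs : 0 < r + s) :
    ∫ t, t ^ j * exp (-(s * t)) ∂gammaMeasure a r =
      r ^ a / Gamma a * ((1 / (r + s)) ^ (a + j) * Gamma (a + j)) := by
  rw [integral_gammaMeasure ha hr, ← integral_rpow_mul_exp_neg_mul_Ioi hj hs]
  congr 1
  exact setIntegral_congr_fun measurableSet_Ioi fun t ht => gammaMeasure_integrand_eq ht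

theorem integrable_exp_gammaMeasure {a r s : ℝ} (ha : 0 < a) (hr : 0 < r) (hs : 0 ≤ s) :
    Integrable (fun t => exp (-(s * t))) (gammaMeasure a r) := by
  simpa using integrable_rpow_mul_exp_gammaMeasure (j := 0) (s := s) ha hr
    (by linarith) (by linarith)

/-- This Laplace transform is what makes the weight a mixture of Gaussians: take `s = ‖x‖ ^ 2`. -/
theorem integral_exp_gammaMeasure {a r s : ℝ} (ha : 0 < a) (hr : 0 < r) (hs : 0 ≤ s) :
    ∫ t, exp (-(s * t)) ∂gammaMeasure a r = (1 + s / r) ^ (-a) := by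
  have h := integral_rpow_mul_exp_gammaMeasure (j := 0) (s := s) ha hr
    (by linarith) (by linarith)
  simp only [rpow_zero, one_mul, add_zero] at h
  have hG := Gamma_pos_of_pos ha
  rw [h, show 1 + s / r = (r + s) / r by field_simp, rpow_neg (by positivity),
    div_rpow (by positivity) hr.le, div_rpow zero_le_one (by positivity), one_rpow]
  have : 0 < r ^ a := by positivity
  have : 0 < (r + s) ^ a := by positivity
  field_simp

theorem integrable_rpow_gammaMeasure {a r j : ℝ} (ha : 0 < a) (hr : 0 < r) (hj : 0 < a + j) :
    Integrable (fun t => t ^ j) (gammaMeasure a r) := by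
  simpa using integrable_rpow_mul_exp_gammaMeasure (s := 0) ha hr hj (by linarith)

theorem integral_rpow_gammaMeasure {a r j : ℝ} (ha : 0 < a) (hr : 0 < r) (hj : 0 < a + j) :
    ∫ t, t ^ j ∂gammaMeasure a r = Gamma (a + j) / Gamma a * r ^ (-j) := by
  have h := integral_rpow_mul_exp_gammaMeasure (s := 0) ha hr hj (by linarith)
  simp only [zero_mul, neg_zero, exp_zero, mul_one, add_zero] at h
  rw [h, div_rpow zero_le_one hr.le, one_rpow, rpow_add hr, rpow_neg hr.le]
  have : 0 < r ^ a := by positivity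
  field_simp

/-! ### Gaussian moments -/

theorem integrable_norm_rpow_mul_exp {n : ℕ} (hn : 1 ≤ n) {b j : ℝ} (hb : 0 < b) (hj : 0 ≤ j) :
    Integrable (fun x : Rn n => ‖x‖ ^ j * exp (-b * ‖x‖ ^ 2)) := by
  have : Nonempty (Fin n) := ⟨⟨0, hn⟩⟩
  have h1 : (0 : ℝ) ≤ (n - 1 : ℕ) := Nat.cast_nonneg _
  rw [integrable_fun_norm_addHaar volume (f := fun y : ℝ => y ^ j * exp (-b * y ^ 2))]
  have h := integrableOn_rpow_mul_exp_neg_mul_sq hb (s := (n - 1 : ℕ) + j) (by linarith)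
  refine h.congr_fun (fun t ht => ?_) measurableSet_Ioi
  simp only [finrank_euclideanSpace, Fintype.card_fin, smul_eq_mul]
  rw [rpow_add ht, rpow_natCast]
  ring

theorem integral_norm_rpow_mul_exp_eq_smul {n : ℕ} (hn : 1 ≤ n) {b j : ℝ} (hb : 0 < b)
    (hj : 0 ≤ j) :
    ∫ x : Rn n, ‖x‖ ^ j * exp (-b * ‖x‖ ^ 2) =
      (n * (volume : Measure (Rn n)).real (Metric.ball 0 1) / 2) *
        (b ^ (-((n + j) / 2)) * Gamma ((n + j) / 2)) := by
  have : Nonempty (Fin n) := ⟨⟨0, hn⟩⟩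
  have h1 : (0 : ℝ) ≤ (n - 1 : ℕ) := Nat.cast_nonneg _
  rw [integral_fun_norm_addHaar volume (f := fun y : ℝ => y ^ j * exp (-b * y ^ 2))]
  have h := integral_rpow_mul_exp_neg_mul_rpow (p := 2) (q := (n - 1 : ℕ) + j) (b := b)
    two_pos (by linarith) hb
  have e : ((n - 1 : ℕ) : ℝ) + j + 1 = n + j := by
    rw [Nat.cast_sub hn]; push_cast; ring
  rw [e, neg_div] at h
  have h2 : ∫ y in Ioi (0 : ℝ), y ^ (Module.finrank ℝ (Rn n) - 1) • (y ^ j * exp (-b * y ^ 2)) =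
      b ^ (-((n + j) / 2)) * (1 / 2) * Gamma ((n + j) / 2) := by
    rw [← h]
    refine setIntegral_congr_fun measurableSet_Ioi fun t ht => ?_
    simp only [finrank_euclideanSpace, Fintype.card_fin, smul_eq_mul, rpow_two]
    rw [rpow_add ht, rpow_natCast]
    ring
  rw [h2]
  simp only [finrank_euclideanSpace, Fintype.card_fin, smul_eq_mul, nsmul_eq_mul]
  ring

/-- Polar coordinates leave the volume of the unit ball as a factor; it is eliminated by comparison
with `j = 0`, the known Gaussian integral. -/
theorem integral_norm_rpow_mul_exp {n : ℕ} (hn : 1 ≤ n) {b j : ℝ} (hb : 0 < b) (hj : 0 ≤ j) :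
    ∫ x : Rn n, ‖x‖ ^ j * exp (-b * ‖x‖ ^ 2) =
      (π / b) ^ ((n : ℝ) / 2) * (b ^ (-(j / 2)) * (Gamma ((n + j) / 2) / Gamma (n / 2))) := by
  have hn' : (0 : ℝ) < n := by exact_mod_cast hn
  have h0 := integral_norm_rpow_mul_exp_eq_smul hn hb le_rfl
  have hG : Gamma ((n : ℝ) / 2) ≠ 0 := (Gamma_pos_of_pos (by positivity)).ne'
  simp only [rpow_zero, one_mul, add_zero] at h0
  rw [GaussianFourier.integral_rexp_neg_mul_sq_norm hb, finrank_euclideanSpace,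
    Fintype.card_fin] at h0
  rw [integral_norm_rpow_mul_exp_eq_smul hn hb hj, h0,
    show -(((n : ℝ) + j) / 2) = -(n / 2) + -(j / 2) by ring, rpow_add hb]
  field_simp

/-! ### Gaussian kernels and their Fourier transforms -/

/-- The Gaussian on `ℝⁿ` whose (inverse) Fourier transform is `x ↦ exp (-t |x|²)`. -/
noncomputable def gaussKer {n : ℕ} (t : ℝ) (ξ : Rn n) : ℝ :=
  (π / t) ^ ((n : ℝ) / 2) * exp (-(π ^ 2 / t) * ‖ξ‖ ^ 2)

theorem gaussKer_nonneg {n : ℕ} {t : ℝ} (ht : 0 < t) (ξ : Rn n) : 0 ≤ gaussKer t ξ := by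
  unfold gaussKer; positivity

theorem measurable_gaussKer {n : ℕ} :
    Measurable (fun p : ℝ × Rn n => gaussKer p.1 p.2) := by
  unfold gaussKer; fun_prop

theorem integrable_norm_rpow_mul_gaussKer {n : ℕ} (hn : 1 ≤ n) {t j : ℝ} (ht : 0 < t)
    (hj : 0 ≤ j) : Integrable (fun ξ : Rn n => ‖ξ‖ ^ j * gaussKer t ξ) := by
  refine ((integrable_norm_rpow_mul_exp hn (b := π ^ 2 / t) (by positivity) hj).const_mul
    ((π / t) ^ ((n : ℝ) / 2))).congr (.of_forall fun ξ => ?_)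
  simp only [gaussKer]; ring

theorem integral_norm_rpow_mul_gaussKer {n : ℕ} (hn : 1 ≤ n) {t j : ℝ} (ht : 0 < t)
    (hj : 0 ≤ j) : ∫ ξ : Rn n, ‖ξ‖ ^ j * gaussKer t ξ =
      (π ^ (-j) * (Gamma ((n + j) / 2) / Gamma (n / 2))) * t ^ (j / 2) := by
  have h : ∀ ξ : Rn n, ‖ξ‖ ^ j * gaussKer t ξ =
      (π / t) ^ ((n : ℝ) / 2) * (‖ξ‖ ^ j * exp (-(π ^ 2 / t) * ‖ξ‖ ^ 2)) := fun ξ => by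
    simp only [gaussKer]; ring
  simp_rw [h]
  rw [integral_const_mul, integral_norm_rpow_mul_exp hn (by positivity) hj, ← mul_assoc,
    ← mul_rpow (by positivity) (by positivity),
    show π / t * (π / (π ^ 2 / t)) = 1 by field_simp, one_rpow, one_mul,
    div_rpow (by positivity) ht.le, ← rpow_natCast, ← rpow_mul pi_pos.le, rpow_neg ht.le]
  rw [show ((2 : ℕ) : ℝ) * -(j / 2) = -j by push_cast; ring]
  field_simp

theorem fourierInv_exp_neg_mul_sq {n : ℕ} {b : ℝ} (hb : 0 < b) (x : Rn n) :
    𝓕⁻ (fun ξ : Rn n => ((exp (-b * ‖ξ‖ ^ 2) : ℝ) : ℂ)) x =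
      (((π / b) ^ ((n : ℝ) / 2) * exp (-(π ^ 2 * ‖x‖ ^ 2 / b)) : ℝ) : ℂ) := by
  have h := fourier_gaussian_innerProductSpace (V := Rn n) (b := b) (by simpa using hb) (-x)
  rw [Real.fourierInv_eq_fourier_neg]
  push_cast at h ⊢
  rw [h, ← Complex.ofReal_div, ← Complex.ofReal_ofNat, ← Complex.ofReal_natCast,
    Complex.ofReal_cpow (by positivity), finrank_euclideanSpace, Fintype.card_fin, norm_neg]
  push_cast
  ring_nf

theorem fourierInv_const_smul {n : ℕ} (c : ℂ) (f : Rn n → ℂ) (x : Rn n) :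
    𝓕⁻ (c • f) x = c • 𝓕⁻ f x := by
  simp_rw [Real.fourierInv_eq, ← integral_smul, Pi.smul_apply, smul_comm c]

theorem fourierInv_exp_mul_gaussKer {n : ℕ} {s t : ℝ} (hs : 0 < s) (ht : 0 ≤ t) (x : Rn n) :
    𝓕⁻ (fun ξ : Rn n => ((exp (-(4 * π ^ 2 * t * ‖ξ‖ ^ 2)) * gaussKer s ξ : ℝ) : ℂ)) x =
      (((1 + 4 * t * s) ^ (-((n : ℝ) / 2)) * exp (-(s * ‖x‖ ^ 2 / (1 + 4 * t * s))) : ℝ) : ℂ) := by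
  have hb : 0 < π ^ 2 / s * (1 + 4 * t * s) := by positivity
  have e : (fun ξ : Rn n => ((exp (-(4 * π ^ 2 * t * ‖ξ‖ ^ 2)) * gaussKer s ξ : ℝ) : ℂ)) =
      ((((π / s) ^ ((n : ℝ) / 2) : ℝ) : ℂ)) • fun ξ : Rn n =>
        ((exp (-(π ^ 2 / s * (1 + 4 * t * s)) * ‖ξ‖ ^ 2) : ℝ) : ℂ) := by
    funext ξ
    rw [Pi.smul_apply, smul_eq_mul, ← Complex.ofReal_mul]
    congr 1
    rw [gaussKer, mul_left_comm, ← exp_add]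
    congr 2
    field_simp
    ring
  rw [e, fourierInv_const_smul, fourierInv_exp_neg_mul_sq hb, smul_eq_mul,
    ← Complex.ofReal_mul, ← mul_assoc, ← mul_rpow (by positivity) (by positivity),
    rpow_neg (by positivity), ← inv_rpow (by positivity)]
  congr 3
  · field_simp
  · field_simp

theorem integrable_fourierChar_smul_prod {n : ℕ} {μ : Measure ℝ} [SFinite μ] {k : ℝ → Rn n → ℂ}
    (hk : Integrable (Function.uncurry k) (μ.prod volume)) (x : Rn n) :
    Integrable (fun p : ℝ × Rn n => Real.fourierChar (inner ℝ p.2 x) • k p.1 p.2)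
      (μ.prod volume) := by
  refine hk.mono ?_ (.of_forall fun p => by simp [Function.uncurry])
  have hc : Continuous fun p : ℝ × Rn n => Real.fourierChar (inner ℝ p.2 x) :=
    Real.continuous_fourierChar.comp (by fun_prop)
  exact hc.aestronglyMeasurable.smul hk.1

theorem fourierInv_integral {n : ℕ} {μ : Measure ℝ} [SFinite μ] {k : ℝ → Rn n → ℂ}
    (hk : Integrable (Function.uncurry k) (μ.prod volume)) (x : Rn n) :
    𝓕⁻ (fun ξ => ∫ t, k t ξ ∂μ) x = ∫ t, 𝓕⁻ (k t) x ∂μ := by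
  simp_rw [Real.fourierInv_eq]
  rw [integral_integral_swap (integrable_fourierChar_smul_prod hk x)]
  refine integral_congr_ae (.of_forall fun ξ => ?_)
  simp only [Circle.smul_def]
  rw [← integral_smul]

/-! ### Gamma mixtures of Gaussians -/

/-- The superposition of the Gaussians `gaussKer t` with `t` distributed according to the Gamma
distribution of shape `a` and rate `r`. Its Fourier transform is `x ↦ (1 + |x|² / r) ^ (-a)`. -/
noncomputable def gaussMix {n : ℕ} (a r : ℝ) (ξ : Rn n) : ℝ :=
  ∫ t, gaussKer t ξ ∂gammaMeasure a r

theorem gaussMix_nonneg {n : ℕ} (a r : ℝ) (ξ : Rn n) : 0 ≤ gaussMix a r ξ := by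
  refine integral_nonneg_of_ae ?_
  filter_upwards [gammaMeasure_ae_pos a r] with t ht using gaussKer_nonneg ht ξ

theorem measurable_gaussMix {n : ℕ} {a r : ℝ} (ha : 0 < a) (hr : 0 < r) :
    Measurable (gaussMix a r : Rn n → ℝ) := by
  have := isProbabilityMeasure_gammaMeasure ha hr
  exact (StronglyMeasurable.integral_prod_left (f := fun t (ξ : Rn n) => gaussKer t ξ)
    measurable_gaussKer.stronglyMeasurable).measurable

/-- By Tonelli, the `ξ`-integral is a multiple of `t ^ (i + j / 2)`, and `hij` says exactly that
this moment of the Gamma law is finite. -/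
theorem integrable_prod_rpow_mul_gaussKer {n : ℕ} (hn : 1 ≤ n) {a r i j : ℝ} (ha : 0 < a)
    (hr : 0 < r) (hj : 0 ≤ j) (hij : 0 < a + (i + j / 2)) :
    Integrable (fun p : ℝ × Rn n => p.1 ^ i * (‖p.2‖ ^ j * gaussKer p.1 p.2))
      ((gammaMeasure a r).prod volume) := by
  have := isProbabilityMeasure_gammaMeasure ha hr
  rw [integrable_prod_iff]
  · constructor
    · filter_upwards [gammaMeasure_ae_pos a r] with t ht
      exact (integrable_norm_rpow_mul_gaussKer hn ht hj).const_mul _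
    · refine ((integrable_rpow_gammaMeasure ha hr hij).const_mul
        (π ^ (-j) * (Gamma ((n + j) / 2) / Gamma (n / 2)))).congr ?_
      filter_upwards [gammaMeasure_ae_pos a r] with t ht
      have h : ∀ ξ : Rn n, ‖t ^ i * (‖ξ‖ ^ j * gaussKer t ξ)‖ =
          t ^ i * (‖ξ‖ ^ j * gaussKer t ξ) := fun ξ => by
        have := gaussKer_nonneg ht ξ
        rw [norm_of_nonneg (by positivity)]
      simp_rw [h]
      rw [integral_const_mul, integral_norm_rpow_mul_gaussKer hn ht hj, rpow_add ht]
      ring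
  · refine Measurable.aestronglyMeasurable ?_
    have := measurable_gaussKer (n := n)
    fun_prop

theorem norm_rpow_mul_gaussMix {n : ℕ} (a r j : ℝ) (ξ : Rn n) :
    ‖ξ‖ ^ j * gaussMix a r ξ =
      ∫ t, t ^ (0 : ℝ) * (‖ξ‖ ^ j * gaussKer t ξ) ∂gammaMeasure a r := by
  simp_rw [rpow_zero, one_mul]
  rw [integral_const_mul, gaussMix]

theorem integrable_norm_rpow_mul_gaussMix {n : ℕ} (hn : 1 ≤ n) {a r j : ℝ} (ha : 0 < a)
    (hr : 0 < r) (hj : 0 ≤ j) : Integrable (fun ξ : Rn n => ‖ξ‖ ^ j * gaussMix a r ξ) := by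
  have := isProbabilityMeasure_gammaMeasure ha hr
  simp_rw [norm_rpow_mul_gaussMix]
  exact (integrable_prod_rpow_mul_gaussKer hn ha hr hj (i := 0) (by positivity)).integral_prod_right

theorem integral_norm_rpow_mul_gaussMix {n : ℕ} (hn : 1 ≤ n) {a r j : ℝ} (ha : 0 < a)
    (hr : 0 < r) (hj : 0 ≤ j) : ∫ ξ : Rn n, ‖ξ‖ ^ j * gaussMix a r ξ =
      (π ^ (-j) * (Gamma ((n + j) / 2) / Gamma (n / 2))) *
        (Gamma (a + j / 2) / Gamma a * r ^ (-(j / 2))) := by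
  have := isProbabilityMeasure_gammaMeasure ha hr
  simp_rw [norm_rpow_mul_gaussMix]
  rw [← integral_integral_swap
    (integrable_prod_rpow_mul_gaussKer hn ha hr hj (i := 0) (by positivity)),
    ← integral_rpow_gammaMeasure ha hr (by positivity), ← integral_const_mul]
  refine integral_congr_ae ?_
  filter_upwards [gammaMeasure_ae_pos a r] with t ht
  simp_rw [rpow_zero, one_mul]
  exact integral_norm_rpow_mul_gaussKer hn ht hj

theorem integrable_gaussMix {n : ℕ} (hn : 1 ≤ n) {a r : ℝ} (ha : 0 < a) (hr : 0 < r) :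
    Integrable (gaussMix a r : Rn n → ℝ) := by
  simpa using integrable_norm_rpow_mul_gaussMix hn ha hr le_rfl

theorem integrable_prod_gaussKer {n : ℕ} (hn : 1 ≤ n) {a r : ℝ} (ha : 0 < a) (hr : 0 < r) :
    Integrable (fun p : ℝ × Rn n => gaussKer p.1 p.2) ((gammaMeasure a r).prod volume) := by
  simpa using integrable_prod_rpow_mul_gaussKer (n := n) (i := 0) (j := 0) hn ha hr le_rfl
    (by simpa)

/-- The value at `x` of the heat flow at time `t` started from `x ↦ (1 + |x|² / r) ^ (-a)`. -/
noncomputable def heatMix {n : ℕ} (a r t : ℝ) (x : Rn n) : ℝ :=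
  ∫ s, (1 + 4 * t * s) ^ (-((n : ℝ) / 2)) * exp (-(s * ‖x‖ ^ 2 / (1 + 4 * t * s)))
    ∂gammaMeasure a r

theorem fourierInv_exp_mul_gaussMix {n : ℕ} (hn : 1 ≤ n) {a r t : ℝ} (ha : 0 < a) (hr : 0 < r)
    (ht : 0 ≤ t) (x : Rn n) :
    𝓕⁻ (fun ξ : Rn n => ((exp (-(4 * π ^ 2 * t * ‖ξ‖ ^ 2)) * gaussMix a r ξ : ℝ) : ℂ)) x =
      (heatMix a r t x : ℂ) := by
  have := isProbabilityMeasure_gammaMeasure ha hr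
  have h : ∀ ξ : Rn n, ((exp (-(4 * π ^ 2 * t * ‖ξ‖ ^ 2)) * gaussMix a r ξ : ℝ) : ℂ) =
      ∫ s, ((exp (-(4 * π ^ 2 * t * ‖ξ‖ ^ 2)) * gaussKer s ξ : ℝ) : ℂ) ∂gammaMeasure a r :=
    fun ξ => by rw [integral_complex_ofReal, integral_const_mul, gaussMix]
  simp_rw [h]
  rw [fourierInv_integral (k := fun s ξ => ((exp (-(4 * π ^ 2 * t * ‖ξ‖ ^ 2)) *
    gaussKer s ξ : ℝ) : ℂ)), heatMix, ← integral_complex_ofReal]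
  · refine integral_congr_ae ?_
    filter_upwards [gammaMeasure_ae_pos a r] with s hs
    exact fourierInv_exp_mul_gaussKer hs ht x
  · refine Integrable.ofReal ?_
    refine (integrable_prod_gaussKer hn ha hr).mono ?_ (.of_forall fun p => ?_)
    · refine Measurable.aestronglyMeasurable ?_
      have := measurable_gaussKer (n := n)
      change Measurable fun p : ℝ × Rn n =>
        exp (-(4 * π ^ 2 * t * ‖p.2‖ ^ 2)) * gaussKer p.1 p.2
      fun_prop
    · change ‖exp (-(4 * π ^ 2 * t * ‖p.2‖ ^ 2)) * gaussKer p.1 p.2‖ ≤ ‖gaussKer p.1 p.2‖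
      rw [norm_mul]
      refine mul_le_of_le_one_left (norm_nonneg _) ?_
      rw [norm_of_nonneg (exp_pos _).le, exp_le_one_iff, neg_nonpos]
      positivity

theorem fourierInv_gaussMix {n : ℕ} (hn : 1 ≤ n) {a r : ℝ} (ha : 0 < a) (hr : 0 < r)
    (x : Rn n) :
    𝓕⁻ (fun ξ : Rn n => (gaussMix a r ξ : ℂ)) x = (((1 + ‖x‖ ^ 2 / r) ^ (-a) : ℝ) : ℂ) := by
  have h := fourierInv_exp_mul_gaussMix hn ha hr le_rfl x
  simp only [mul_zero, zero_mul, neg_zero, exp_zero, one_mul, heatMix, add_zero, one_rpow,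
    div_one] at h
  rw [h, ← integral_exp_gammaMeasure ha hr (sq_nonneg ‖x‖)]
  simp_rw [mul_comm]

theorem gaussKer_sq {n : ℕ} {t : ℝ} (ht : 0 < t) (ξ : Rn n) :
    gaussKer t ξ ^ 2 = (π / 2) ^ ((n : ℝ) / 2) * (t ^ (-((n : ℝ) / 2)) * gaussKer (t / 2) ξ) := by
  unfold gaussKer
  rw [mul_pow, ← exp_nat_mul, show ((2 : ℕ) : ℝ) * (-(π ^ 2 / t) * ‖ξ‖ ^ 2) =
    -(π ^ 2 / (t / 2)) * ‖ξ‖ ^ 2 by push_cast; field_simp, ← mul_assoc, ← mul_assoc]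
  congr 1
  rw [← rpow_natCast, ← rpow_mul (by positivity), mul_comm ((n : ℝ) / 2),
    rpow_mul (by positivity), rpow_neg ht.le, ← inv_rpow ht.le,
    ← mul_rpow (by positivity) (by positivity), ← mul_rpow (by positivity) (by positivity)]
  congr 1
  rw [show ((2 : ℕ) : ℝ) = 1 + 1 by norm_num, rpow_add (by positivity), rpow_one]
  field_simp

theorem integrable_prod_sq_gaussKer {n : ℕ} (hn : 1 ≤ n) {a r i : ℝ} (ha : 0 < a)
    (hr : 0 < r) (hi : 0 < a + (i + 1 - (n : ℝ) / 2)) :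
    Integrable (fun p : ℝ × Rn n => p.1 ^ i * (‖p.2‖ * gaussKer p.1 p.2) ^ 2)
      ((gammaMeasure a r).prod volume) := by
  have := isProbabilityMeasure_gammaMeasure ha hr
  rw [integrable_prod_iff]
  · have key : ∀ t : ℝ, 0 < t → ∀ ξ : Rn n, t ^ i * (‖ξ‖ * gaussKer t ξ) ^ 2 =
        ((π / 2) ^ ((n : ℝ) / 2) * (t ^ i * t ^ (-((n : ℝ) / 2)))) *
          (‖ξ‖ ^ (2 : ℝ) * gaussKer (t / 2) ξ) := fun t ht ξ => by
      rw [mul_pow, gaussKer_sq ht, rpow_two]; ring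
    constructor
    · filter_upwards [gammaMeasure_ae_pos a r] with t ht
      simp_rw [key t ht]
      exact (integrable_norm_rpow_mul_gaussKer hn (half_pos ht) zero_le_two).const_mul _
    · refine ((integrable_rpow_gammaMeasure ha hr hi).const_mul
        ((π / 2) ^ ((n : ℝ) / 2) * (π ^ (-2 : ℝ) * (Gamma ((n + 2) / 2) / Gamma (n / 2))) *
          2⁻¹)).congr ?_
      filter_upwards [gammaMeasure_ae_pos a r] with t ht
      have h : ∀ ξ : Rn n, ‖t ^ i * (‖ξ‖ * gaussKer t ξ) ^ 2‖ =
          t ^ i * (‖ξ‖ * gaussKer t ξ) ^ 2 := fun ξ => by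
        rw [norm_of_nonneg (by positivity)]
      simp_rw [h, key t ht]
      rw [integral_const_mul, integral_norm_rpow_mul_gaussKer hn (half_pos ht) zero_le_two,
        show i + 1 - (n : ℝ) / 2 = i + -((n : ℝ) / 2) + 1 by ring, rpow_add ht, rpow_add ht,
        rpow_one, div_self two_ne_zero, rpow_one]
      ring
  · refine Measurable.aestronglyMeasurable ?_
    have := measurable_gaussKer (n := n)
    fun_prop

/-- Cauchy–Schwarz in the mixing variable, with `t ^ (±(a - 1) / 2)` inserted, bounds the square of
the mixture by a mixture of squares. The two Gamma moments needed have total exponents `a - (a - 1)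
= 1` and `2 * a - n / 2`, so `n / 4 < a`, that is `n / 2 < q`, suffices. -/
theorem memLp_norm_mul_gaussMix {n : ℕ} (hn : 1 ≤ n) {a r : ℝ} (ha : (n : ℝ) / 4 < a)
    (hr : 0 < r) : MemLp (fun ξ : Rn n => ‖ξ‖ * gaussMix a r ξ) 2 := by
  have hn' : (0 : ℝ) < n := by exact_mod_cast hn
  have ha' : 0 < a := by linarith [div_pos hn' (four_pos : (0 : ℝ) < 4)]
  have := isProbabilityMeasure_gammaMeasure ha' hr
  have hm : AEStronglyMeasurable (fun ξ : Rn n => ‖ξ‖ * gaussMix a r ξ) volume :=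
    (measurable_norm.mul (measurable_gaussMix ha' hr)).aestronglyMeasurable
  rw [memLp_two_iff_integrable_sq hm]
  have hI := integrable_prod_sq_gaussKer (n := n) (i := a - 1) hn ha' hr (by linarith)
  have hsec := hI.prod_left_ae
  have hint := hI.integral_prod_right
  have hmom : Integrable (fun t : ℝ => t ^ (-(a - 1))) (gammaMeasure a r) :=
    integrable_rpow_gammaMeasure ha' hr (by linarith)
  refine (hint.const_mul (∫ t, t ^ (-(a - 1)) ∂gammaMeasure a r)).mono' (hm.pow 2) ?_
  filter_upwards [hsec] with ξ hξ
  rw [norm_of_nonneg (sq_nonneg _)]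
  have hmeas : Measurable (fun t : ℝ => gaussKer t ξ) :=
    (measurable_gaussKer (n := n)).comp (measurable_id.prodMk measurable_const)
  have hpos := gammaMeasure_ae_pos a r
  have sq1 : ∀ t : ℝ, 0 < t → (t ^ (-((a - 1) / 2))) ^ (2 : ℝ) = t ^ (-(a - 1)) := fun t ht => by
    rw [← rpow_mul ht.le]; ring_nf
  have sq2 : ∀ t : ℝ, 0 < t → (t ^ ((a - 1) / 2) * (‖ξ‖ * gaussKer t ξ)) ^ (2 : ℝ) =
      t ^ (a - 1) * (‖ξ‖ * gaussKer t ξ) ^ 2 := fun t ht => by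
    have := gaussKer_nonneg ht ξ
    rw [mul_rpow (by positivity) (by positivity), ← rpow_mul ht.le, rpow_two (‖ξ‖ * _)]; ring_nf
  have hcs := integral_mul_le_Lp_mul_Lq_of_nonneg (μ := gammaMeasure a r) (p := 2) (q := 2)
    (f := fun t => t ^ (-((a - 1) / 2))) (g := fun t => t ^ ((a - 1) / 2) * (‖ξ‖ * gaussKer t ξ))
    (by constructor <;> norm_num)
    (by filter_upwards [hpos] with t ht; positivity)
    (by filter_upwards [hpos] with t ht; have := gaussKer_nonneg ht ξ; positivity)
    (by
      rw [ENNReal.ofReal_ofNat, memLp_two_iff_integrable_sq (by fun_prop)]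
      refine hmom.congr ?_
      filter_upwards [hpos] with t ht
      rw [← sq1 t ht, rpow_two])
    (by
      rw [ENNReal.ofReal_ofNat, memLp_two_iff_integrable_sq (by fun_prop)]
      refine hξ.congr ?_
      filter_upwards [hpos] with t ht
      rw [← sq2 t ht, rpow_two])
  have e1 : ∫ t, t ^ (-((a - 1) / 2)) * (t ^ ((a - 1) / 2) * (‖ξ‖ * gaussKer t ξ))
      ∂gammaMeasure a r = ‖ξ‖ * gaussMix a r ξ := by
    rw [gaussMix, ← integral_const_mul]
    refine integral_congr_ae ?_
    filter_upwards [hpos] with t ht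
    rw [← mul_assoc, ← rpow_add ht, neg_add_cancel, rpow_zero, one_mul]
  have e2 : ∫ t, (t ^ (-((a - 1) / 2))) ^ (2 : ℝ) ∂gammaMeasure a r =
      ∫ t, t ^ (-(a - 1)) ∂gammaMeasure a r := by
    refine integral_congr_ae ?_
    filter_upwards [hpos] with t ht using sq1 t ht
  have e3 : ∫ t, (t ^ ((a - 1) / 2) * (‖ξ‖ * gaussKer t ξ)) ^ (2 : ℝ) ∂gammaMeasure a r =
      ∫ t, t ^ (a - 1) * (‖ξ‖ * gaussKer t ξ) ^ 2 ∂gammaMeasure a r := by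
    refine integral_congr_ae ?_
    filter_upwards [hpos] with t ht using sq2 t ht
  rw [e1, e2, e3] at hcs
  have h0 : 0 ≤ ‖ξ‖ * gaussMix a r ξ := mul_nonneg (norm_nonneg _) (gaussMix_nonneg _ _ _)
  have hA : 0 ≤ ∫ t, t ^ (-(a - 1)) ∂gammaMeasure a r := integral_nonneg_of_ae (by
    filter_upwards [hpos] with t ht; positivity)
  have hB : 0 ≤ ∫ t, t ^ (a - 1) * (‖ξ‖ * gaussKer t ξ) ^ 2 ∂gammaMeasure a r :=
    integral_nonneg_of_ae (by filter_upwards [hpos] with t ht; positivity)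
  calc (‖ξ‖ * gaussMix a r ξ) ^ 2 ≤ _ := pow_le_pow_left₀ h0 hcs 2
    _ = _ := by
      rw [mul_pow, ← rpow_natCast, ← rpow_natCast, ← rpow_mul hA, ← rpow_mul hB]
      norm_num

/-! ### Identification of the Fourier transform on `L²` -/

theorem integral_fourierInv_mul_eq {n : ℕ} {f g : Rn n → ℂ} (hf : Integrable f)
    (hg : Integrable g) : ∫ x, 𝓕⁻ f x * g x = ∫ x, f x * 𝓕⁻ g x := by
  have h := VectorFourier.integral_fourierIntegral_smul_eq_flip (L := -innerₗ (Rn n))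
    (μ := volume) (ν := volume) Real.continuous_fourierChar
    (by simp only [LinearMap.neg_apply, innerₗ_apply_apply]; fun_prop) hf hg
  have e : (-innerₗ (Rn n)).flip = -innerₗ (Rn n) := by
    ext x y; simp [real_inner_comm]
  rw [e] at h
  exact h

/-- Both sides are locally integrable, so it is enough to pair them with test functions. As tempered
distributions, the Fourier transform moves to the test function and then back onto `G` by the
multiplication formula. -/
theorem fourierL2_ae_eq {n : ℕ} {f G : Rn n → ℂ} (hG : Integrable G) (hf : MemLp f 2)
    (h : ∀ x, 𝓕⁻ G x = f x) : fourierL2 f =ᵐ[volume] G := by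
  rw [fourierL2, dif_pos hf]
  refine ae_eq_of_integral_contDiff_smul_eq ((Lp.memLp _).locallyIntegrable one_le_two)
    hG.locallyIntegrable fun g g_smooth g_cpt => ?_
  have hg₁ : HasCompactSupport (Complex.ofRealCLM ∘ g) := g_cpt.comp_left rfl
  have hg₂ : ContDiff ℝ ((⊤ : ℕ∞) : WithTop ℕ∞) (Complex.ofRealCLM ∘ g) := by fun_prop
  let φ : 𝓢(Rn n, ℂ) := hg₁.toSchwartzMap hg₂
  have hφ : ∀ x, φ x = (g x : ℂ) := fun x => rfl
  calc ∫ x, g x • (𝓕 (hf.toLp f) : Lp ℂ 2 (volume : Measure (Rn n))) x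
      = Lp.toTemperedDistribution (𝓕 (hf.toLp f) : Lp ℂ 2 (volume : Measure (Rn n))) φ := by
        simp [hφ]
    _ = Lp.toTemperedDistribution (hf.toLp f) (𝓕 φ) := by
        rw [← Lp.fourier_toTemperedDistribution_eq, TemperedDistribution.fourier_apply]
    _ = ∫ x, 𝓕⁻ G x * (𝓕 φ) x := by
        rw [Lp.toTemperedDistribution_apply]
        refine integral_congr_ae ?_
        filter_upwards [hf.coeFn_toLp] with x hx
        rw [hx, h, smul_eq_mul, mul_comm]
    _ = ∫ x, G x * φ x := by
        rw [integral_fourierInv_mul_eq hG (𝓕 φ).integrable]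
        congr 1
        funext x
        rw [← SchwartzMap.fourierInv_coe, FourierTransform.fourierInv_fourier_eq]
    _ = ∫ x, g x • G x := by
        congr 1
        funext x
        rw [hφ, mul_comm, Complex.real_smul]

theorem fourierL2_schwartz_ae_eq {n : ℕ} (φ : 𝓢(Rn n, ℂ)) :
    fourierL2 φ =ᵐ[volume] (𝓕 φ : 𝓢(Rn n, ℂ)) := by
  refine fourierL2_ae_eq (𝓕 φ).integrable (φ.memLp 2) fun x => ?_
  rw [← SchwartzMap.fourierInv_coe, FourierTransform.fourierInv_fourier_eq]

/-! ### The symbol and the square root as a superposition of exponentials -/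

theorem symb_nonneg {n : ℕ} (m : ℝ) (ξ : Rn n) : 0 ≤ symb m ξ := sqrt_nonneg _

theorem symb_smul_le {n : ℕ} (m : ℝ) (ξ : Rn n) :
    symb m ((2 * π) • ξ) ≤ |m| + 2 * π * ‖ξ‖ := by
  unfold symb
  rw [norm_smul, norm_of_nonneg two_pi_pos.le]
  refine sqrt_le_iff.2 ⟨by positivity, ?_⟩
  have : 0 ≤ |m| * (2 * π * ‖ξ‖) := by positivity
  nlinarith [sq_abs m]

theorem measurable_symb {n : ℕ} (m : ℝ) : Measurable (symb m : Rn n → ℝ) := by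
  unfold symb; fun_prop

/-- The constant `∫ (1 - exp (-t)) t^{-3/2} dt` (which is `2 √π`). -/
noncomputable def sqrtConst : ℝ := ∫ t in Ioi (0 : ℝ), (1 - exp (-t)) * t ^ (-(3 / 2) : ℝ)

theorem integrableOn_one_sub_exp : IntegrableOn
    (fun t : ℝ => (1 - exp (-t)) * t ^ (-(3 / 2) : ℝ)) (Ioi 0) := by
  rw [← Ioc_union_Ioi_eq_Ioi zero_le_one, integrableOn_union]
  constructor
  · have h : IntegrableOn (fun t : ℝ => t ^ (-(1 / 2) : ℝ)) (Ioc 0 1) := by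
      rw [← intervalIntegrable_iff_integrableOn_Ioc_of_le zero_le_one]
      exact intervalIntegral.intervalIntegrable_rpow' (by norm_num)
    refine h.mono' (Measurable.aestronglyMeasurable (by fun_prop)) ?_
    filter_upwards [ae_restrict_mem measurableSet_Ioc] with t ht
    have ht0 : 0 < t := ht.1
    have h1 : 0 ≤ 1 - exp (-t) := by
      rw [sub_nonneg, exp_le_one_iff]; linarith
    rw [norm_of_nonneg (by positivity),
      show (-(1 / 2) : ℝ) = 1 + -(3 / 2) by norm_num, rpow_add ht0, rpow_one]
    gcongr
    linarith [add_one_le_exp (-t)]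
  · have h : IntegrableOn (fun t : ℝ => t ^ (-(3 / 2) : ℝ)) (Ioi 1) :=
      integrableOn_Ioi_rpow_of_lt (by norm_num) one_pos
    refine h.mono' (Measurable.aestronglyMeasurable (by fun_prop)) ?_
    filter_upwards [ae_restrict_mem measurableSet_Ioi] with t ht
    have ht0 : 0 < t := lt_trans one_pos ht
    have h1 : 0 ≤ 1 - exp (-t) := by
      rw [sub_nonneg, exp_le_one_iff]; linarith
    rw [norm_of_nonneg (by positivity)]
    refine mul_le_of_le_one_left (by positivity) ?_
    linarith [exp_pos (-t)]

theorem sqrtConst_pos : 0 < sqrtConst := by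
  unfold sqrtConst
  rw [setIntegral_pos_iff_support_of_nonneg_ae ?_ integrableOn_one_sub_exp]
  · refine lt_of_lt_of_le (by simp : (0 : ENNReal) < volume (Ioi (0 : ℝ)))
      (measure_mono fun t (ht : 0 < t) => ⟨?_, ht⟩)
    have h1 : 0 < 1 - exp (-t) := by
      rw [sub_pos, exp_lt_one_iff]; linarith
    exact (by positivity : 0 < (1 - exp (-t)) * t ^ (-(3 / 2) : ℝ)).ne'
  · filter_upwards [ae_restrict_mem measurableSet_Ioi] with t ht
    have ht0 : 0 < t := ht
    have h1 : 0 ≤ 1 - exp (-t) := by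
      rw [sub_nonneg, exp_le_one_iff]; linarith
    simp only [Pi.zero_apply]
    positivity

theorem one_sub_exp_scaling {l t : ℝ} (hl : 0 < l) (ht : 0 < t) :
    (1 - exp (-(l * t))) * t ^ (-(3 / 2) : ℝ) =
      l ^ (3 / 2 : ℝ) * ((1 - exp (-(l * t))) * (l * t) ^ (-(3 / 2) : ℝ)) := by
  rw [mul_rpow hl.le ht.le, rpow_neg hl.le]
  have : 0 < l ^ (3 / 2 : ℝ) := by positivity
  field_simp

theorem integrableOn_one_sub_exp_mul {l : ℝ} (hl : 0 ≤ l) : IntegrableOn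
    (fun t : ℝ => (1 - exp (-(l * t))) * t ^ (-(3 / 2) : ℝ)) (Ioi 0) := by
  rcases hl.eq_or_lt with rfl | hl
  · simp
  · have h := (integrableOn_Ioi_comp_mul_left_iff
      (fun t : ℝ => (1 - exp (-t)) * t ^ (-(3 / 2) : ℝ)) 0 hl).2
      (by simpa using integrableOn_one_sub_exp)
    refine IntegrableOn.congr_fun (Integrable.const_mul h (l ^ (3 / 2 : ℝ)))
      (fun t ht => (one_sub_exp_scaling hl ht).symm) measurableSet_Ioi

/-- The substitution `t ↦ l * t` extracts `√l`. The constant cancels later, so only its positivity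
matters. -/
theorem integral_one_sub_exp_mul {l : ℝ} (hl : 0 ≤ l) :
    ∫ t in Ioi (0 : ℝ), (1 - exp (-(l * t))) * t ^ (-(3 / 2) : ℝ) = sqrtConst * sqrt l := by
  rcases hl.eq_or_lt with rfl | hl
  · simp
  · have h := integral_comp_mul_left_Ioi
      (fun t : ℝ => (1 - exp (-t)) * t ^ (-(3 / 2) : ℝ)) 0 hl
    rw [setIntegral_congr_fun measurableSet_Ioi (fun t ht => one_sub_exp_scaling hl ht),
      integral_const_mul, h, mul_zero, ← sqrtConst, smul_eq_mul, ← mul_assoc,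
      show (3 / 2 : ℝ) = 1 + 1 / 2 by norm_num, rpow_add hl, rpow_one, sqrt_eq_rpow]
    field_simp

/-! ### The weight, its Fourier transform and the domain of the operator -/

theorem jap_rpow_neg {V : Type*} [Norm V] (x : V) (q : ℝ) :
    jap x ^ (-q) = (1 + ‖x‖ ^ 2) ^ (-(q / 2)) := by
  rw [jap, sqrt_eq_rpow, ← rpow_mul (by positivity)]
  ring_nf

theorem weight_apply {n : ℕ} {q R : ℝ} (hR : 0 < R) (x : Rn n) :
    weight n q R x = (((1 + ‖x‖ ^ 2 / R ^ 2) ^ (-(q / 2)) : ℝ) : ℂ) := by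
  rw [weight, jap_rpow_neg, norm_smul, norm_of_nonneg (by positivity)]
  congr 3
  field_simp

theorem memLp_weight {n : ℕ} {q R : ℝ} (hq : (n : ℝ) / 2 < q) (hR : 0 < R) :
    MemLp (weight n q R) 2 := by
  have hm : Measurable (weight n q R) := by
    unfold weight jap
    fun_prop
  rw [memLp_two_iff_integrable_sq_norm hm.aestronglyMeasurable]
  have h := (integrable_rpow_neg_one_add_norm_sq (E := Rn n) (μ := volume) (r := 2 * q)
    (by rw [finrank_euclideanSpace, Fintype.card_fin]; linarith)).comp_smul
    (inv_pos.2 hR).ne'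
  refine h.congr (.of_forall fun x => ?_)
  simp only [weight]
  have h0 : 0 ≤ jap (R⁻¹ • x) ^ (-q) := rpow_nonneg (sqrt_nonneg _) _
  rw [Complex.norm_real, norm_of_nonneg h0, jap_rpow_neg,
    ← rpow_two ((1 + ‖R⁻¹ • x‖ ^ 2) ^ _), ← rpow_mul (by positivity)]
  congr 1
  ring

theorem fourierL2_weight {n : ℕ} (hn : 1 ≤ n) {q R : ℝ} (hq : (n : ℝ) / 2 < q) (hR : 0 < R) :
    fourierL2 (weight n q R) =ᵐ[volume] fun ξ => (gaussMix (q / 2) (R ^ 2) ξ : ℂ) := by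
  have hn' : (0 : ℝ) < n := by exact_mod_cast hn
  have hq' : 0 < q / 2 := by linarith
  refine fourierL2_ae_eq (integrable_gaussMix hn hq' (by positivity)).ofReal
    (memLp_weight hq hR) fun x => ?_
  rw [fourierInv_gaussMix hn hq' (by positivity), weight_apply hR]

theorem multiplied_weight {n : ℕ} (hn : 1 ≤ n) {q R : ℝ} (hq : (n : ℝ) / 2 < q) (hR : 0 < R)
    (m : ℝ) : multiplied (symb m) (weight n q R) =ᵐ[volume]
      fun ξ => ((symb m ((2 * π) • ξ) * gaussMix (q / 2) (R ^ 2) ξ : ℝ) : ℂ) := by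
  filter_upwards [fourierL2_weight hn hq hR] with ξ hξ
  rw [multiplied, hξ, Complex.ofReal_mul]

theorem integrable_symb_mul_gaussMix {n : ℕ} (hn : 1 ≤ n) {a r : ℝ} (ha : 0 < a)
    (hr : 0 < r) (m : ℝ) :
    Integrable (fun ξ : Rn n => symb m ((2 * π) • ξ) * gaussMix a r ξ) := by
  have h1 := integrable_norm_rpow_mul_gaussMix hn ha hr zero_le_one
  have h0 := integrable_gaussMix hn ha hr
  refine ((h0.const_mul |m|).add (h1.const_mul (2 * π))).mono' ?_ (.of_forall fun ξ => ?_)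
  · exact (((measurable_symb m).comp (measurable_const_smul _)).mul
      (measurable_gaussMix ha hr)).aestronglyMeasurable
  · have h := gaussMix_nonneg a r ξ
    rw [norm_of_nonneg (mul_nonneg (symb_nonneg _ _) h)]
    refine (mul_le_mul_of_nonneg_right (symb_smul_le m ξ) h).trans_eq ?_
    simp only [Pi.add_apply, rpow_one]
    ring

/-- No estimate is needed: by Plancherel it is the `L²` Fourier transform of the weight. -/
theorem memLp_gaussMix {n : ℕ} (hn : 1 ≤ n) {q R : ℝ} (hq : (n : ℝ) / 2 < q) (hR : 0 < R) :
    MemLp (fun ξ : Rn n => gaussMix (q / 2) (R ^ 2) ξ) 2 := by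
  have h : MemLp (fourierL2 (weight n q R)) 2 := by
    rw [fourierL2, dif_pos (memLp_weight hq hR)]
    exact Lp.memLp _
  simpa using (h.ae_eq (fourierL2_weight hn hq hR)).re

theorem multiplierDefined_weight {n : ℕ} (hn : 1 ≤ n) {q R : ℝ} (hq : (n : ℝ) / 2 < q)
    (hR : 0 < R) (m : ℝ) : MultiplierDefined (symb m) (weight n q R) where
  memLp := memLp_weight hq hR
  memLp_multiplied := by
    have hn' : (0 : ℝ) < n := by exact_mod_cast hn
    have hr : 0 < R ^ 2 := by positivity
    have h1 := memLp_norm_mul_gaussMix hn (a := q / 2) (by linarith) hr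
    have h0 := memLp_gaussMix hn hq hR
    have h2 : MemLp (fun ξ : Rn n => symb m ((2 * π) • ξ) * gaussMix (q / 2) (R ^ 2) ξ) 2 := ?_
    · exact (h2.ofReal (K := ℂ)).ae_eq (multiplied_weight hn hq hR m).symm
    refine ((h0.const_mul |m|).add (h1.const_mul (2 * π))).mono
      (integrable_symb_mul_gaussMix hn (by linarith) hr m).1 (.of_forall fun ξ => ?_)
    have h := gaussMix_nonneg (q / 2) (R ^ 2) ξ
    rw [norm_of_nonneg (mul_nonneg (symb_nonneg _ _) h)]
    refine (mul_le_mul_of_nonneg_right (symb_smul_le m ξ) h).trans (le_trans (le_of_eq ?_)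
      (le_abs_self _))
    simp only [Pi.add_apply]
    ring
  integrable_multiplied := by
    have hn' : (0 : ℝ) < n := by exact_mod_cast hn
    exact ((integrable_symb_mul_gaussMix hn (a := q / 2) (by linarith)
      (by positivity : 0 < R ^ 2) m).ofReal).congr (multiplied_weight hn hq hR m).symm

/-! ### The representation through the heat flow -/

theorem fourierInv_sub {n : ℕ} {f g : Rn n → ℂ} (hf : Integrable f) (hg : Integrable g)
    (x : Rn n) : 𝓕⁻ (fun ξ => f ξ - g ξ) x = 𝓕⁻ f x - 𝓕⁻ g x := by
  have key : ∀ {h : Rn n → ℂ}, Integrable h →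
      Integrable fun ξ => Real.fourierChar (inner ℝ ξ x) • h ξ := fun {h} hh => by
    have hc : Continuous fun ξ : Rn n => Real.fourierChar (inner ℝ ξ x) :=
      Real.continuous_fourierChar.comp (by fun_prop)
    exact hh.mono (hc.aestronglyMeasurable.smul hh.1) (.of_forall fun ξ => by simp)
  simp_rw [Real.fourierInv_eq, smul_sub]
  exact integral_sub (key hf) (key hg)

/-- Justifies exchanging the `t`-integral with the inverse Fourier integral. The integrand is
nonnegative, and integrating in `t` first gives `sqrtConst` times the integrable function `symb m *
gaussMix`. -/
theorem integrable_prod_one_sub_exp_mul_gaussMix {n : ℕ} (hn : 1 ≤ n) {a r : ℝ} (ha : 0 < a)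
    (hr : 0 < r) (m : ℝ) :
    Integrable (fun p : ℝ × Rn n => (1 - exp (-((m ^ 2 + ‖(2 * π) • p.2‖ ^ 2) * p.1))) *
      p.1 ^ (-(3 / 2) : ℝ) * gaussMix a r p.2) ((volume.restrict (Ioi 0)).prod volume) := by
  rw [integrable_prod_iff']
  · constructor
    · refine .of_forall fun ξ => ?_
      have h := integrableOn_one_sub_exp_mul (l := m ^ 2 + ‖(2 * π) • ξ‖ ^ 2) (by positivity)
      exact Integrable.mul_const h (gaussMix a r ξ)
    · refine ((integrable_symb_mul_gaussMix hn ha hr m).const_mul sqrtConst).congr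
        (.of_forall fun ξ => ?_)
      have h : ∀ t ∈ Ioi (0 : ℝ), ‖(1 - exp (-((m ^ 2 + ‖(2 * π) • ξ‖ ^ 2) * t))) *
          t ^ (-(3 / 2) : ℝ) * gaussMix a r ξ‖ = (1 - exp (-((m ^ 2 + ‖(2 * π) • ξ‖ ^ 2) * t))) *
          t ^ (-(3 / 2) : ℝ) * gaussMix a r ξ := fun t ht => by
        have ht0 : 0 < t := ht
        have h1 : 0 ≤ 1 - exp (-((m ^ 2 + ‖(2 * π) • ξ‖ ^ 2) * t)) := by
          rw [sub_nonneg, exp_le_one_iff, neg_nonpos]; positivity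
        have := gaussMix_nonneg a r ξ
        rw [norm_of_nonneg (by positivity)]
      simp only
      rw [setIntegral_congr_fun measurableSet_Ioi h, integral_mul_const,
        integral_one_sub_exp_mul (by positivity), ← symb, mul_assoc]
  · refine Measurable.aestronglyMeasurable ?_
    have := measurable_gaussMix (n := n) ha hr
    fun_prop

theorem fourierInv_one_sub_exp_mul_gaussMix {n : ℕ} (hn : 1 ≤ n) {a r t : ℝ} (ha : 0 < a)
    (hr : 0 < r) (ht : 0 ≤ t) (m : ℝ) (x : Rn n) :
    𝓕⁻ (fun ξ : Rn n => (((1 - exp (-((m ^ 2 + ‖(2 * π) • ξ‖ ^ 2) * t))) *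
      t ^ (-(3 / 2) : ℝ) * gaussMix a r ξ : ℝ) : ℂ)) x =
      ((((1 + ‖x‖ ^ 2 / r) ^ (-a) - exp (-(m ^ 2 * t)) * heatMix a r t x) *
        t ^ (-(3 / 2) : ℝ) : ℝ) : ℂ) := by
  have hG := integrable_gaussMix hn ha hr
  have e : (fun ξ : Rn n => (((1 - exp (-((m ^ 2 + ‖(2 * π) • ξ‖ ^ 2) * t))) *
      t ^ (-(3 / 2) : ℝ) * gaussMix a r ξ : ℝ) : ℂ)) =
      ((t ^ (-(3 / 2) : ℝ) : ℝ) : ℂ) • fun ξ => ((gaussMix a r ξ : ℂ) -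
        (((exp (-(m ^ 2 * t)) : ℝ) : ℂ) •
          fun ξ : Rn n => ((exp (-(4 * π ^ 2 * t * ‖ξ‖ ^ 2)) * gaussMix a r ξ : ℝ) : ℂ)) ξ) := by
    funext ξ
    simp only [Pi.smul_apply, smul_eq_mul]
    rw [norm_smul, norm_of_nonneg two_pi_pos.le,
      show -((m ^ 2 + (2 * π * ‖ξ‖) ^ 2) * t) = -(m ^ 2 * t) + -(4 * π ^ 2 * t * ‖ξ‖ ^ 2) by ring,
      exp_add]
    push_cast
    ring
  have hE : Integrable fun ξ : Rn n => exp (-(4 * π ^ 2 * t * ‖ξ‖ ^ 2)) * gaussMix a r ξ := by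
    refine hG.mono ?_ (.of_forall fun ξ => ?_)
    · have := measurable_gaussMix (n := n) ha hr
      exact Measurable.aestronglyMeasurable (by fun_prop)
    · rw [norm_mul]
      refine mul_le_of_le_one_left (norm_nonneg _) ?_
      rw [norm_of_nonneg (exp_pos _).le, exp_le_one_iff, neg_nonpos]
      positivity
  have hG' : Integrable fun ξ : Rn n => (gaussMix a r ξ : ℂ) := hG.ofReal
  have hE' : Integrable fun ξ : Rn n =>
      ((exp (-(4 * π ^ 2 * t * ‖ξ‖ ^ 2)) * gaussMix a r ξ : ℝ) : ℂ) := hE.ofReal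
  rw [e, fourierInv_const_smul, fourierInv_sub hG' (hE'.smul _), fourierInv_gaussMix hn ha hr,
    fourierInv_const_smul, fourierInv_exp_mul_gaussMix hn ha hr ht]
  simp only [smul_eq_mul]
  push_cast
  ring

/-- The real integrand in the representation of `(m² - Δ)^{1/2}` through the heat flow. -/
noncomputable def heatIntegrand {n : ℕ} (a m : ℝ) (x : Rn n) (t : ℝ) : ℝ :=
  ((1 + ‖x‖ ^ 2) ^ (-a) - exp (-(m ^ 2 * t)) * heatMix a 1 t x) * t ^ (-(3 / 2) : ℝ)

/-- Fubini gives this without examining the cancellation at `t = 0`: the integrand is the real part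
of an inverse Fourier integral of a jointly integrable function. -/
theorem integrableOn_heatIntegrand {n : ℕ} (hn : 1 ≤ n) {a : ℝ} (ha : 0 < a) (m : ℝ) (x : Rn n) :
    IntegrableOn (heatIntegrand a m x) (Ioi 0) := by
  have h := (integrable_fourierChar_smul_prod (k := fun t ξ => (((1 - exp (-((m ^ 2 +
    ‖(2 * π) • ξ‖ ^ 2) * t))) * t ^ (-(3 / 2) : ℝ) * gaussMix a 1 ξ : ℝ) : ℂ))
    (integrable_prod_one_sub_exp_mul_gaussMix hn ha one_pos m).ofReal x).integral_prod_left.re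
  refine IntegrableOn.congr_fun h (fun t ht => ?_) measurableSet_Ioi
  have e := fourierInv_one_sub_exp_mul_gaussMix hn ha one_pos (le_of_lt ht) m x
  rw [Real.fourierInv_eq] at e
  simp only
  rw [e, RCLike.re_eq_complex_re, Complex.ofReal_re, div_one, heatIntegrand]

theorem sqrtOp_weight_eq {n : ℕ} (hn : 1 ≤ n) {q : ℝ} (hq : (n : ℝ) / 2 < q) (m : ℝ)
    (x : Rn n) : sqrtOp m (weight n q 1) x =
      ((sqrtConst⁻¹ * ∫ t in Ioi 0, heatIntegrand (q / 2) m x t : ℝ) : ℂ) := by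
  have hn' : (0 : ℝ) < n := by exact_mod_cast hn
  have hq' : 0 < q / 2 := by linarith
  have h1 : 𝓕⁻ (multiplied (symb m) (weight n q 1)) x = 𝓕⁻ ((((sqrtConst⁻¹ : ℝ)) : ℂ) •
      fun ξ : Rn n => ∫ t in Ioi (0 : ℝ), (((1 - exp (-((m ^ 2 +
    ‖(2 * π) • ξ‖ ^ 2) * t))) * t ^ (-(3 / 2) : ℝ) * gaussMix (q / 2) 1 ξ : ℝ) : ℂ)) x := by
    refine Real.fourierInv_congr_ae ?_ x
    filter_upwards [multiplied_weight hn hq one_pos m] with ξ hξ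
    rw [hξ, Pi.smul_apply, integral_complex_ofReal, integral_mul_const,
      integral_one_sub_exp_mul (by positivity), ← symb, smul_eq_mul, ← Complex.ofReal_mul,
      one_pow]
    congr 1
    have := sqrtConst_pos
    field_simp
  rw [sqrtOp, multiplier, h1, fourierInv_const_smul, fourierInv_integral
    (integrable_prod_one_sub_exp_mul_gaussMix hn hq' one_pos m).ofReal, smul_eq_mul,
    Complex.ofReal_mul, ← integral_complex_ofReal]
  congr 1
  refine setIntegral_congr_fun measurableSet_Ioi fun t ht => ?_
  rw [fourierInv_one_sub_exp_mul_gaussMix hn hq' one_pos (le_of_lt ht), div_one, heatIntegrand]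

theorem integrable_heatMix_integrand {n : ℕ} {a r t : ℝ} (ha : 0 < a) (hr : 0 < r) (ht : 0 ≤ t)
    (x : Rn n) : Integrable (fun s : ℝ => (1 + 4 * t * s) ^ (-((n : ℝ) / 2)) *
      exp (-(s * ‖x‖ ^ 2 / (1 + 4 * t * s)))) (gammaMeasure a r) := by
  have := isProbabilityMeasure_gammaMeasure ha hr
  refine (integrable_const (1 : ℝ)).mono' (Measurable.aestronglyMeasurable (by fun_prop)) ?_
  filter_upwards [gammaMeasure_ae_pos a r] with s hs
  rw [norm_of_nonneg (by positivity)]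
  refine mul_le_one₀ ?_ (exp_pos _).le ?_
  · exact rpow_le_one_of_one_le_of_nonpos (le_add_of_nonneg_right (by positivity))
      (by simp; positivity)
  · rw [exp_le_one_iff, neg_nonpos]; positivity

theorem heatMix_nonneg {n : ℕ} {a r t : ℝ} (ht : 0 ≤ t) (x : Rn n) : 0 ≤ heatMix a r t x := by
  refine integral_nonneg_of_ae ?_
  filter_upwards [gammaMeasure_ae_pos a r] with s hs
  simp only [Pi.zero_apply]
  positivity

/-- For each Gaussian in the mixture, `1 + 4ts ≤ e^{4ts}` in the prefactor and dropping the
denominator in the exponent give at least `exp (-(‖x‖² + 2nt) s)`. Averaging over `s` gives `(1 +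
‖x‖² + 2nt)^{-a}`, and `1 + ‖x‖² + 2nt ≤ e^{2nt} (1 + ‖x‖²)`. -/
theorem le_heatMix {n : ℕ} {a t : ℝ} (ha : 0 < a) (ht : 0 ≤ t) (x : Rn n) :
    exp (-(2 * a * n * t)) * (1 + ‖x‖ ^ 2) ^ (-a) ≤ heatMix a 1 t x := by
  have h1 : (1 + (‖x‖ ^ 2 + 2 * n * t)) ^ (-a) ≤ heatMix a 1 t x := by
    have h := integral_exp_gammaMeasure (s := ‖x‖ ^ 2 + 2 * n * t) ha one_pos (by positivity)
    rw [div_one] at h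
    rw [← h]
    refine integral_mono_ae (integrable_exp_gammaMeasure ha one_pos (by positivity))
      (integrable_heatMix_integrand ha one_pos ht x) ?_
    filter_upwards [gammaMeasure_ae_pos a 1] with s hs
    rw [show -((‖x‖ ^ 2 + 2 * n * t) * s) = (4 * t * s) * (-((n : ℝ) / 2)) + -(s * ‖x‖ ^ 2) by
      ring, exp_add, exp_mul]
    refine mul_le_mul ?_ ?_ (exp_pos _).le (by positivity)
    · refine rpow_le_rpow_of_nonpos (by positivity) ?_ (by simp; positivity)
      linarith [add_one_le_exp (4 * t * s)]
    · rw [exp_le_exp, neg_le_neg_iff]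
      exact div_le_self (by positivity) (le_add_of_nonneg_right (by positivity))
  refine le_trans ?_ h1
  rw [show -(2 * a * n * t) = (2 * n * t) * (-a) by ring, exp_mul,
    ← mul_rpow (exp_pos _).le (by positivity)]
  refine rpow_le_rpow_of_nonpos (by positivity) ?_ (by linarith)
  have h2 := add_one_le_exp (2 * n * t)
  have h3 : 0 ≤ 2 * n * t := by positivity
  nlinarith [sq_nonneg ‖x‖]

theorem norm_sqrtOp_weight_le {n : ℕ} (hn : 1 ≤ n) {q : ℝ} (hq : (n : ℝ) / 2 < q) (m : ℝ)
    (x : Rn n) : ‖sqrtOp m (weight n q 1) x‖ ≤ ‖sqrtOp 0 (weight n q 1) x‖ +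
      sqrt (m ^ 2 + q * n) * jap x ^ (-q) := by
  have hn' : (0 : ℝ) < n := by exact_mod_cast hn
  have hq' : 0 < q / 2 := by linarith
  have hC := sqrtConst_pos
  rw [sqrtOp_weight_eq hn hq, sqrtOp_weight_eq hn hq, Complex.norm_real, Complex.norm_real,
    Real.norm_eq_abs, Real.norm_eq_abs, jap_rpow_neg]
  -- Lower bound: the mass only damps the nonnegative heat flow, which is subtracted.
  have h1 : ∫ t in Ioi 0, heatIntegrand (q / 2) 0 x t ≤
      ∫ t in Ioi 0, heatIntegrand (q / 2) m x t := by
    refine setIntegral_mono_on (integrableOn_heatIntegrand hn hq' 0 x)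
      (integrableOn_heatIntegrand hn hq' m x) measurableSet_Ioi fun t ht => ?_
    have ht0 : 0 < t := ht
    unfold heatIntegrand
    refine mul_le_mul_of_nonneg_right (sub_le_sub_left ?_ _) (by positivity)
    refine mul_le_mul_of_nonneg_right ?_ (heatMix_nonneg ht0.le x)
    rw [exp_le_exp]
    have : 0 ≤ m ^ 2 * t := by positivity
    linarith
  -- Upper bound: inserting `le_heatMix` leaves the integral for `√l` with `l = m ^ 2 + q * n`.
  have h2 : ∫ t in Ioi 0, heatIntegrand (q / 2) m x t ≤
      sqrtConst * sqrt (m ^ 2 + q * n) * (1 + ‖x‖ ^ 2) ^ (-(q / 2)) := by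
    have hl : 0 ≤ m ^ 2 + q * n := by
      have : 0 < q := by linarith
      positivity
    rw [← integral_one_sub_exp_mul hl, ← integral_mul_const]
    refine setIntegral_mono_on (integrableOn_heatIntegrand hn hq' m x)
      (Integrable.mul_const (integrableOn_one_sub_exp_mul hl) _) measurableSet_Ioi fun t ht => ?_
    have ht0 : 0 < t := ht
    have h := le_heatMix hq' ht0.le x
    unfold heatIntegrand
    rw [mul_right_comm]
    refine mul_le_mul_of_nonneg_right ?_ (by positivity)
    rw [sub_mul, one_mul]
    refine sub_le_sub_left ?_ _
    rw [show -((m ^ 2 + q * n) * t) = -(m ^ 2 * t) + -(2 * (q / 2) * n * t) by ring, exp_add,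
      mul_assoc]
    exact mul_le_mul_of_nonneg_left h (exp_pos _).le
  have h3 : 0 ≤ sqrt (m ^ 2 + q * n) * (1 + ‖x‖ ^ 2) ^ (-(q / 2)) := by positivity
  have h1' := mul_le_mul_of_nonneg_left h1 (inv_pos.2 hC).le
  have h2' := mul_le_mul_of_nonneg_left h2 (inv_pos.2 hC).le
  rw [mul_assoc sqrtConst, inv_mul_cancel_left₀ hC.ne'] at h2'
  rw [abs_le]
  constructor
  · linarith [neg_abs_le (sqrtConst⁻¹ * ∫ t in Ioi 0, heatIntegrand (q / 2) 0 x t)]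
  · linarith [abs_nonneg (sqrtConst⁻¹ * ∫ t in Ioi 0, heatIntegrand (q / 2) 0 x t)]

/-! ### The Bessel kernel: existence and uniqueness almost everywhere -/

/-- The kernel of the Bessel potential `(1 - Δ)^{-1/2}` as a mixture of Gaussians. -/
noncomputable def besselKer {n : ℕ} (y : Rn n) : ℝ := gaussMix (1 / 2) (1 / (4 * π ^ 2)) y

theorem besselKer_neg {n : ℕ} (y : Rn n) : besselKer (-y) = besselKer y := by
  simp [besselKer, gaussMix, gaussKer]

theorem besselKer_nonneg {n : ℕ} (y : Rn n) : 0 ≤ besselKer y := gaussMix_nonneg _ _ _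

theorem measurable_besselKer {n : ℕ} : Measurable (besselKer : Rn n → ℝ) :=
  measurable_gaussMix (by norm_num) (by positivity)

theorem integrable_norm_rpow_mul_besselKer {n : ℕ} (hn : 1 ≤ n) {j : ℝ} (hj : 0 ≤ j) :
    Integrable (fun y : Rn n => ‖y‖ ^ j * besselKer y) :=
  integrable_norm_rpow_mul_gaussMix hn (by norm_num) (by positivity) hj

theorem integrable_besselKer {n : ℕ} (hn : 1 ≤ n) : Integrable (besselKer : Rn n → ℝ) :=
  integrable_gaussMix hn (by norm_num) (by positivity)

/-- Shape `1 / 2` yields the inverse square root, and rate `1 / (4 * π ^ 2)` absorbs the `2 * π` of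
the frequency normalization. -/
theorem fourierInv_besselKer {n : ℕ} (hn : 1 ≤ n) (ξ : Rn n) :
    𝓕⁻ (fun y : Rn n => (besselKer y : ℂ)) ξ = (((symb 1 ((2 * π) • ξ))⁻¹ : ℝ) : ℂ) := by
  have h := fourierInv_gaussMix hn (a := 1 / 2) (r := 1 / (4 * π ^ 2)) (by norm_num)
    (by positivity) ξ
  simp only [besselKer]
  rw [h, symb, norm_smul, norm_of_nonneg two_pi_pos.le, rpow_neg (by positivity), sqrt_eq_rpow]
  congr 3
  field_simp
  ring

theorem integrable_besselKer_mul_schwartz {n : ℕ} (hn : 1 ≤ n) (φ : 𝓢(Rn n, ℂ)) (x : Rn n) :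
    Integrable (fun y => (besselKer y : ℂ) * φ (x - y)) := by
  have hb : Integrable fun y : Rn n => (besselKer y : ℂ) := (integrable_besselKer hn).ofReal
  refine hb.mul_bdd (c := SchwartzMap.seminorm ℝ 0 0 φ)
    (φ.continuous.comp (by fun_prop)).aestronglyMeasurable (.of_forall fun y => ?_)
  exact SchwartzMap.norm_le_seminorm ℝ φ (x - y)

theorem isBesselKernel_besselKer {n : ℕ} (hn : 1 ≤ n) :
    IsBesselKernel (besselKer : Rn n → ℝ) where
  measurable := measurable_besselKer
  integrable_conv := integrable_besselKer_mul_schwartz hn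
  conv_eq φ x := by
    have hc : Continuous fun ξ : Rn n => Real.fourierChar (inner ℝ ξ x) :=
      Real.continuous_fourierChar.comp (by fun_prop)
    have hφ : Integrable fun ξ : Rn n => (Real.fourierChar (inner ℝ ξ x) : ℂ) * (𝓕 φ) ξ :=
      (𝓕 φ).integrable.mono
        ((continuous_subtype_val.comp hc).aestronglyMeasurable.mul
          (𝓕 φ).continuous.aestronglyMeasurable)
        (.of_forall fun ξ => by rw [norm_mul, Circle.norm_coe, one_mul])
    have hK : Integrable fun y : Rn n => (besselKer y : ℂ) := (integrable_besselKer hn).ofReal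
    calc multiplier (fun ξ => (symb 1 ξ)⁻¹) φ x
        = 𝓕⁻ (fun ξ => (((symb 1 ((2 * π) • ξ))⁻¹ : ℝ) : ℂ) * (𝓕 φ) ξ) x := by
          refine Real.fourierInv_congr_ae ?_ x
          filter_upwards [fourierL2_schwartz_ae_eq φ] with ξ hξ
          rw [multiplied, hξ]
      _ = ∫ ξ, 𝓕⁻ (fun y : Rn n => (besselKer y : ℂ)) ξ *
            ((Real.fourierChar (inner ℝ ξ x) : ℂ) * (𝓕 φ) ξ) := by
          rw [Real.fourierInv_eq]
          congr 1
          funext ξ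
          rw [fourierInv_besselKer hn, Circle.smul_def, smul_eq_mul]
          ring
      _ = ∫ y, (besselKer y : ℂ) * φ (x + y) := by
          rw [integral_fourierInv_mul_eq hK hφ]
          congr 1
          funext y
          congr 1
          have h : 𝓕⁻ (𝓕 φ) (x + y) = φ (x + y) := by
            rw [FourierTransform.fourierInv_fourier_eq]
          rw [← h, SchwartzMap.fourierInv_coe, Real.fourierInv_eq, Real.fourierInv_eq]
          congr 1
          funext ξ
          rw [Circle.smul_def, Circle.smul_def, inner_add_right, AddChar.map_add_eq_mul,
            Circle.coe_mul, smul_eq_mul, smul_eq_mul]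
          ring
      _ = ∫ y, (besselKer y : ℂ) * φ (x - y) := by
          rw [← integral_neg_eq_self]
          simp_rw [besselKer_neg, ← sub_eq_add_neg]

/-- Convolution with a bump centred at `-x`, evaluated at `0`, integrates `K` with weight `1` near
`x`. -/
theorem IsBesselKernel.locallyIntegrable {n : ℕ} {K : Rn n → ℝ} (hK : IsBesselKernel K) :
    LocallyIntegrable (fun y => (K y : ℂ)) := by
  intro x
  let f : ContDiffBump (-x) := ⟨1, 2, one_pos, one_lt_two⟩
  have hg₁ : HasCompactSupport (Complex.ofRealCLM ∘ f) := f.hasCompactSupport.comp_left rfl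
  have hg₂ : ContDiff ℝ ((⊤ : ℕ∞) : WithTop ℕ∞) (Complex.ofRealCLM ∘ f) := by
    have := f.contDiff (n := ((⊤ : ℕ∞)))
    fun_prop
  let φ : 𝓢(Rn n, ℂ) := hg₁.toSchwartzMap hg₂
  have hφ : ∀ y, φ y = (f y : ℂ) := fun y => rfl
  refine ⟨Metric.ball x 1, Metric.ball_mem_nhds x one_pos, ?_⟩
  refine IntegrableOn.congr_fun (hK.integrable_conv φ 0).integrableOn (fun y hy => ?_)
    Metric.isOpen_ball.measurableSet
  have h1 : f (0 - y) = 1 := by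
    refine f.one_of_mem_closedBall ?_
    rw [Metric.mem_closedBall, zero_sub, dist_neg_neg]
    exact (Metric.mem_ball.1 hy).le
  rw [hφ, h1, Complex.ofReal_one, mul_one]

theorem IsBesselKernel.ae_eq {n : ℕ} {K L : Rn n → ℝ} (hK : IsBesselKernel K)
    (hL : IsBesselKernel L) : K =ᵐ[volume] L := by
  have h : ∀ᵐ y, (K y : ℂ) = (L y : ℂ) := by
    refine ae_eq_of_integral_contDiff_smul_eq hK.locallyIntegrable hL.locallyIntegrable
      fun g g_smooth g_cpt => ?_
    -- Convolving with the reflection of `g` and evaluating at `0` gives the pairing with `g`.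
    have hg₁ : HasCompactSupport (Complex.ofRealCLM ∘ g ∘ Neg.neg) :=
      (g_cpt.comp_homeomorph (Homeomorph.neg (Rn n))).comp_left rfl
    have hg₂ : ContDiff ℝ ((⊤ : ℕ∞) : WithTop ℕ∞) (Complex.ofRealCLM ∘ g ∘ Neg.neg) := by
      have : ContDiff ℝ ((⊤ : ℕ∞) : WithTop ℕ∞) (g ∘ Neg.neg) := g_smooth.comp contDiff_neg
      fun_prop
    let φ : 𝓢(Rn n, ℂ) := hg₁.toSchwartzMap hg₂
    have hφ : ∀ y, φ (0 - y) = (g y : ℂ) := fun y => by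
      change ((g (-(0 - y)) : ℝ) : ℂ) = _
      simp
    have e := (hK.conv_eq φ 0).symm.trans (hL.conv_eq φ 0)
    simp_rw [hφ] at e
    simp_rw [Complex.real_smul, mul_comm]
    simpa [mul_comm] using e
  filter_upwards [h] with y hy using Complex.ofReal_injective hy

/-! ### Moments of the Bessel kernel and lower bounds for its weighted norm -/

theorem one_le_jap {V : Type*} [Norm V] (x : V) : 1 ≤ jap x := by
  rw [jap, one_le_sqrt]
  nlinarith [sq_nonneg ‖x‖]

theorem integrable_jap_rpow_mul_besselKer {n : ℕ} (hn : 1 ≤ n) {q : ℝ} (hq : 0 ≤ q) :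
    Integrable (fun y : Rn n => jap y ^ q * besselKer y) := by
  refine (((integrable_besselKer hn).add (integrable_norm_rpow_mul_besselKer hn hq)).const_mul
    ((2 : ℝ) ^ q)).mono' ?_ (.of_forall fun y => ?_)
  · have : Measurable (jap : Rn n → ℝ) := by unfold jap; fun_prop
    have := measurable_besselKer (n := n)
    exact Measurable.aestronglyMeasurable (by fun_prop)
  · have h0 := besselKer_nonneg y
    have h1 := one_le_jap y
    rw [norm_of_nonneg (by positivity)]
    have h2 : jap y ^ q ≤ 2 ^ q * (1 + ‖y‖ ^ q) := by
      have h3 : jap y ≤ 2 * max 1 ‖y‖ := by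
        rw [jap]
        refine sqrt_le_iff.2 ⟨by positivity, ?_⟩
        have := le_max_left 1 ‖y‖
        have := le_max_right 1 ‖y‖
        nlinarith [norm_nonneg y]
      refine (rpow_le_rpow (by positivity) h3 hq).trans ?_
      rw [mul_rpow zero_le_two (by positivity)]
      refine mul_le_mul_of_nonneg_left ?_ (by positivity)
      have h4 : 0 ≤ ‖y‖ ^ q := by positivity
      rcases max_choice 1 ‖y‖ with h | h <;> rw [h]
      · rw [one_rpow]; linarith
      · linarith
    refine (mul_le_mul_of_nonneg_right h2 h0).trans_eq ?_
    simp only [Pi.add_apply]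
    ring

theorem weightedNorm_besselKer {n : ℕ} (q : ℝ) :
    weightedNorm q (besselKer : Rn n → ℝ) = ∫ y : Rn n, jap y ^ q * besselKer y := by
  unfold weightedNorm
  congr 1
  funext y
  have := one_le_jap y
  have := besselKer_nonneg y
  rw [norm_of_nonneg (by positivity)]

theorem integral_besselKer {n : ℕ} (hn : 1 ≤ n) : ∫ y : Rn n, besselKer y = 1 := by
  have hn' : (0 : ℝ) < n := by exact_mod_cast hn
  have h := integral_norm_rpow_mul_gaussMix hn (a := 1 / 2) (r := 1 / (4 * π ^ 2)) (j := 0)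
    (by norm_num) (by positivity) le_rfl
  have h1 := (Gamma_pos_of_pos (by positivity : 0 < (n : ℝ) / 2)).ne'
  have h2 := (Gamma_pos_of_pos (by norm_num : (0 : ℝ) < 1 / 2)).ne'
  simp only [rpow_zero, one_mul, neg_zero, zero_div, add_zero, div_self h1, div_self h2] at h
  exact h

theorem integral_norm_sq_mul_besselKer {n : ℕ} (hn : 1 ≤ n) :
    ∫ y : Rn n, ‖y‖ ^ 2 * besselKer y = n := by
  have hn' : (0 : ℝ) < n := by exact_mod_cast hn
  have h := integral_norm_rpow_mul_gaussMix hn (a := 1 / 2) (r := 1 / (4 * π ^ 2)) (j := 2)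
    (by norm_num) (by positivity) zero_le_two
  have h1 := (Gamma_pos_of_pos (by positivity : 0 < (n : ℝ) / 2)).ne'
  have h2 := (Gamma_pos_of_pos (by norm_num : (0 : ℝ) < 1 / 2)).ne'
  simp_rw [rpow_two] at h
  rw [show ((n : ℝ) + 2) / 2 = n / 2 + 1 by ring, show (1 / 2 + 2 / 2 : ℝ) = 1 / 2 + 1 by norm_num,
    Gamma_add_one (by positivity), Gamma_add_one (by norm_num), rpow_neg pi_pos.le, rpow_two,
    div_self two_ne_zero, rpow_neg (by positivity), rpow_one] at h
  simp only [besselKer]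
  rw [h]
  field_simp
  ring

theorem integral_norm_pow_four_mul_besselKer {n : ℕ} (hn : 1 ≤ n) :
    ∫ y : Rn n, ‖y‖ ^ 4 * besselKer y = 3 * n * (n + 2) := by
  have hn' : (0 : ℝ) < n := by exact_mod_cast hn
  have h := integral_norm_rpow_mul_gaussMix hn (a := 1 / 2) (r := 1 / (4 * π ^ 2))
    (j := ((4 : ℕ) : ℝ)) (by norm_num) (by positivity) (by norm_num)
  have h1 := (Gamma_pos_of_pos (by positivity : 0 < (n : ℝ) / 2)).ne'
  have h2 := (Gamma_pos_of_pos (by norm_num : (0 : ℝ) < 1 / 2)).ne'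
  have e : ((4 : ℕ) : ℝ) / 2 = ((2 : ℕ) : ℝ) := by norm_num
  simp_rw [rpow_natCast] at h
  rw [show ((n : ℝ) + (4 : ℕ)) / 2 = n / 2 + 1 + 1 by push_cast; ring,
    show (1 / 2 + ((4 : ℕ) : ℝ) / 2 : ℝ) = 1 / 2 + 1 + 1 by norm_num,
    Gamma_add_one (by positivity), Gamma_add_one (by positivity), Gamma_add_one (by norm_num),
    Gamma_add_one (by norm_num), rpow_neg pi_pos.le, rpow_natCast,
    rpow_neg (by positivity), e, rpow_natCast] at h
  simp only [besselKer]
  rw [h]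
  field_simp
  ring

theorem integrable_norm_pow_mul_besselKer {n : ℕ} (hn : 1 ≤ n) (k : ℕ) :
    Integrable (fun y : Rn n => ‖y‖ ^ k * besselKer y) := by
  simpa using integrable_norm_rpow_mul_besselKer hn (Nat.cast_nonneg k : (0 : ℝ) ≤ k)

theorem one_le_weightedNorm {n : ℕ} (hn : 1 ≤ n) {q : ℝ} (hq : 0 ≤ q) :
    1 ≤ weightedNorm q (besselKer : Rn n → ℝ) := by
  rw [weightedNorm_besselKer, ← integral_besselKer hn]
  refine integral_mono (integrable_besselKer hn) (integrable_jap_rpow_mul_besselKer hn hq)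
    fun y => ?_
  exact le_mul_of_one_le_left (besselKer_nonneg y) (one_le_rpow (one_le_jap y) hq)

theorem one_add_le_weightedNorm {n : ℕ} (hn : 1 ≤ n) {q : ℝ} (hq : 2 ≤ q) :
    1 + (n : ℝ) ≤ weightedNorm q (besselKer : Rn n → ℝ) := by
  have h2 := integrable_norm_pow_mul_besselKer hn 2
  rw [weightedNorm_besselKer, ← integral_norm_sq_mul_besselKer hn, ← integral_besselKer hn,
    ← integral_add (integrable_besselKer hn) h2]
  refine integral_mono ((integrable_besselKer hn).add h2)
    (integrable_jap_rpow_mul_besselKer hn (by linarith)) fun y => ?_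
  have h := rpow_le_rpow_of_exponent_le (one_le_jap y) hq
  rw [rpow_two, jap, sq_sqrt (by positivity)] at h
  refine le_trans (le_of_eq ?_) (mul_le_mul_of_nonneg_right h (besselKer_nonneg y))
  ring

/-- A quadratic minorant turns the weighted norm into moments of orders 0, 2 and 4. With `w = √(1 +
z)` the defect is `(w - 1) (w - 4)² (w + 9) / 200`: equality at `z = 0` and tangency at `z = 15`. -/
theorem le_sqrt_one_add {z : ℝ} (hz : 0 ≤ z) : 1 + z * (55 - z) / 200 ≤ sqrt (1 + z) := by
  set w := sqrt (1 + z) with hw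
  have h1 : 1 ≤ w := one_le_sqrt.2 (by linarith)
  have h2 : z = w ^ 2 - 1 := by rw [hw, sq_sqrt (by linarith)]; ring
  rw [h2]
  have h3 : 0 ≤ (w - 1) * ((w - 4) ^ 2 * (w + 9)) :=
    mul_nonneg (by linarith) (mul_nonneg (sq_nonneg _) (by linarith))
  nlinarith

theorem quartic_le_weightedNorm {n : ℕ} (hn : 1 ≤ n) {q : ℝ} (hq : 1 ≤ q) :
    1 + (55 * (n : ℝ) - 3 * n * (n + 2)) / 200 ≤ weightedNorm q (besselKer : Rn n → ℝ) := by
  have h0 := integrable_besselKer hn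
  have h2 := (integrable_norm_pow_mul_besselKer hn 2).const_mul (55 / 200)
  have h4 := (integrable_norm_pow_mul_besselKer hn 4).const_mul (1 / 200)
  have e : ∫ y : Rn n, (besselKer y + 55 / 200 * (‖y‖ ^ 2 * besselKer y) -
      1 / 200 * (‖y‖ ^ 4 * besselKer y)) = 1 + (55 * (n : ℝ) - 3 * n * (n + 2)) / 200 := by
    have h02 : Integrable fun y : Rn n => besselKer y + 55 / 200 * (‖y‖ ^ 2 * besselKer y) :=
      h0.add h2
    rw [integral_sub h02 h4, integral_add h0 h2, integral_const_mul, integral_const_mul,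
      integral_besselKer hn, integral_norm_sq_mul_besselKer hn,
      integral_norm_pow_four_mul_besselKer hn]
    ring
  rw [weightedNorm_besselKer, ← e]
  refine integral_mono ((h0.add h2).sub h4)
    (integrable_jap_rpow_mul_besselKer hn (by linarith)) fun y => ?_
  have h := rpow_le_rpow_of_exponent_le (one_le_jap y) hq
  rw [rpow_one] at h
  have h' := (le_sqrt_one_add (sq_nonneg ‖y‖)).trans h
  refine le_trans (le_of_eq ?_) (mul_le_mul_of_nonneg_right h' (besselKer_nonneg y))
  ring

/-- Bernoulli supplies `1 + q ≤ 2 ^ q` for `1 ≤ q`. If `2 ≤ q`, the second moment bounds the norm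
below by `1 + n`. If `q < 2`, only `n = 1, 2, 3` remain: total mass suffices for `n = 1`, and the
quartic bound handles `n = 2, 3`. -/
theorem mul_le_two_rpow_mul_weightedNorm_sq {n : ℕ} (hn : 1 ≤ n) {q : ℝ}
    (hq : (n : ℝ) / 2 < q) :
    q * n ≤ 2 ^ q * weightedNorm q (besselKer : Rn n → ℝ) ^ 2 := by
  have hn' : (1 : ℝ) ≤ n := by exact_mod_cast hn
  have h1 := one_le_weightedNorm hn (by linarith : 0 ≤ q)
  have bern : 1 ≤ q → 1 + q ≤ (2 : ℝ) ^ q := fun h => by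
    have := one_add_mul_self_le_rpow_one_add (by norm_num : (-1 : ℝ) ≤ 1) h
    rw [mul_one, one_add_one_eq_two] at this
    exact this
  rcases le_or_gt 2 q with h2 | h2
  · have hB := one_add_le_weightedNorm hn h2
    calc q * n ≤ (1 + q) * (1 + n) ^ 2 := by
          have : 0 ≤ q * n := by positivity
          nlinarith [sq_nonneg (n : ℝ), mul_nonneg (by linarith : 0 ≤ q) (sq_nonneg (n : ℝ))]
      _ ≤ _ := by
        gcongr
        exact bern (by linarith)
  · have hn4 : n < 4 := by
      have : (n : ℝ) < (4 : ℕ) := by push_cast; linarith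
      exact_mod_cast this
    interval_cases n
    · have h3 : q ≤ (2 : ℝ) ^ q := by
        rcases le_or_gt 1 q with h | h
        · linarith [bern h]
        · exact h.le.trans (one_le_rpow one_le_two (by norm_num at hq; linarith))
      have h4 : (1 : ℝ) ≤ weightedNorm q (besselKer : Rn 1 → ℝ) ^ 2 := one_le_pow₀ h1
      push_cast
      nlinarith
    · norm_num at hq
      have hB := quartic_le_weightedNorm hn hq.le
      norm_num at hB
      have h3 := bern hq.le
      -- `143 / 100` is the value of the quartic lower bound at `n = 2`; for `n = 3` it is `8 / 5`.
      calc q * (2 : ℕ) ≤ (1 + q) * (143 / 100) ^ 2 := by push_cast; nlinarith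
        _ ≤ _ := by gcongr
    · norm_num at hq
      have hB := quartic_le_weightedNorm hn (by linarith : 1 ≤ q)
      norm_num at hB
      have h3 := bern (by linarith)
      calc q * (3 : ℕ) ≤ (1 + q) * (8 / 5) ^ 2 := by push_cast; nlinarith
        _ ≤ _ := by gcongr

theorem sqrt_le_two_rpow_mul_weightedNorm {n : ℕ} (hn : 1 ≤ n) {q : ℝ} (hq : (n : ℝ) / 2 < q)
    (m : ℝ) : sqrt (m ^ 2 + q * n) ≤
      (2 : ℝ) ^ (q / 2) * weightedNorm q (besselKer : Rn n → ℝ) * jap m ^ (q + 1) := by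
  have hn' : (1 : ℝ) ≤ n := by exact_mod_cast hn
  have hq0 : 0 ≤ q := by linarith
  have h1 := one_le_weightedNorm hn hq0
  have hj := one_le_jap m
  have h2 : jap m ≤ jap m ^ (q + 1) := by
    simpa using rpow_le_rpow_of_exponent_le hj (by linarith : (1 : ℝ) ≤ q + 1)
  have h3 : (1 : ℝ) ≤ 2 ^ q * weightedNorm q (besselKer : Rn n → ℝ) ^ 2 :=
    one_le_mul_of_one_le_of_one_le (one_le_rpow one_le_two hq0) (one_le_pow₀ h1)
  have h4 := mul_le_two_rpow_mul_weightedNorm_sq hn hq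
  refine le_trans ?_ (mul_le_mul_of_nonneg_left h2 (by positivity))
  refine sqrt_le_iff.2 ⟨by positivity, ?_⟩
  have e : ((2 : ℝ) ^ (q / 2)) ^ 2 = 2 ^ q := by
    rw [← rpow_two, ← rpow_mul zero_le_two]; ring_nf
  rw [mul_pow, mul_pow, e, jap, sq_sqrt (by positivity), Real.norm_eq_abs, sq_abs]
  nlinarith [sq_nonneg m]

/-! ### Scaling -/

theorem fourierInv_comp_smul {n : ℕ} {R : ℝ} (hR : 0 < R) (g : Rn n → ℂ) (x : Rn n) :
    𝓕⁻ (fun ξ => g (R • ξ)) x = (((R ^ n)⁻¹ : ℝ) : ℂ) * 𝓕⁻ g (R⁻¹ • x) := by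
  have h := Measure.integral_comp_smul (volume : Measure (Rn n))
    (fun ξ => Real.fourierChar (inner ℝ ξ (R⁻¹ • x)) • g ξ) R
  rw [finrank_euclideanSpace, Fintype.card_fin, abs_of_pos (by positivity), ← Real.fourierInv_eq,
    Complex.real_smul] at h
  rw [← h, Real.fourierInv_eq]
  congr 1
  funext ξ
  rw [real_inner_smul_left, real_inner_smul_right, mul_inv_cancel_left₀ hR.ne']

/-- A second description of the same transform, as a dilate of the case `R = 1`; the scaling law of
the operator is read off from it. -/
theorem fourierL2_weight_scaling {n : ℕ} (hn : 1 ≤ n) {q R : ℝ} (hq : (n : ℝ) / 2 < q)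
    (hR : 0 < R) : fourierL2 (weight n q R) =ᵐ[volume]
      (((R ^ n : ℝ) : ℂ) • fun ξ => (gaussMix (q / 2) 1 (R • ξ) : ℂ)) := by
  have hn' : (0 : ℝ) < n := by exact_mod_cast hn
  have hq' : 0 < q / 2 := by linarith
  have hG : Integrable fun ξ : Rn n => (gaussMix (q / 2) 1 ξ : ℂ) :=
    (integrable_gaussMix hn hq' one_pos).ofReal
  refine fourierL2_ae_eq ((hG.comp_smul hR.ne').smul _) (memLp_weight hq hR) fun x => ?_
  rw [fourierInv_const_smul, fourierInv_comp_smul hR fun ξ => (gaussMix (q / 2) 1 ξ : ℂ),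
    fourierInv_gaussMix hn hq' one_pos, weight_apply hR, smul_eq_mul, ← mul_assoc,
    ← Complex.ofReal_mul, mul_inv_cancel₀ (by positivity), Complex.ofReal_one, one_mul,
    norm_smul, norm_of_nonneg (by positivity)]
  congr 3
  field_simp

theorem symb_scaling {n : ℕ} {R : ℝ} (hR : 0 < R) (m : ℝ) (ξ : Rn n) :
    symb m ξ = R⁻¹ * symb (R * m) (R • ξ) := by
  unfold symb
  rw [norm_smul, norm_of_nonneg hR.le,
    show (R * m) ^ 2 + (R * ‖ξ‖) ^ 2 = R ^ 2 * (m ^ 2 + ‖ξ‖ ^ 2) by ring,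
    sqrt_mul (by positivity), sqrt_sq hR.le, inv_mul_cancel_left₀ hR.ne']

theorem sqrtOp_weight_scaling {n : ℕ} (hn : 1 ≤ n) {q R : ℝ} (hq : (n : ℝ) / 2 < q)
    (hR : 0 < R) (m : ℝ) (x : Rn n) :
    sqrtOp m (weight n q R) x =
      ((R⁻¹ : ℝ) : ℂ) * sqrtOp (R * m) (weight n q 1) (R⁻¹ • x) := by
  have h1 : multiplied (symb m) (weight n q R) =ᵐ[volume]
      (((R⁻¹ * R ^ n : ℝ) : ℂ) • fun ξ => (fun ξ : Rn n =>
        ((symb (R * m) ((2 * π) • ξ) * gaussMix (q / 2) (1 ^ 2) ξ : ℝ) : ℂ)) (R • ξ)) := by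
    filter_upwards [fourierL2_weight_scaling hn hq hR] with ξ hξ
    rw [multiplied, hξ, symb_scaling hR, smul_comm R, one_pow]
    simp only [Pi.smul_apply, smul_eq_mul]
    push_cast
    ring
  rw [sqrtOp, multiplier, Real.fourierInv_congr_ae h1, fourierInv_const_smul,
    fourierInv_comp_smul hR fun ξ : Rn n =>
      ((symb (R * m) ((2 * π) • ξ) * gaussMix (q / 2) (1 ^ 2) ξ : ℝ) : ℂ), sqrtOp, multiplier,
    Real.fourierInv_congr_ae (multiplied_weight hn hq one_pos (R * m)), smul_eq_mul, ← mul_assoc,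
    ← Complex.ofReal_mul, mul_inv_cancel_right₀ (by positivity)]

/-! ### The massless bound -/

/-- The substitution `s ↦ s⁻¹` fixes `s + s⁻¹`; this is the symmetry `K_{1/2} = K_{-1/2}` of
Macdonald functions. -/
theorem integral_inversion_Ioi (c : ℝ) :
    ∫ s in Ioi (0 : ℝ), s ^ (-(3 / 2) : ℝ) * exp (-(c * (s + s⁻¹))) =
      ∫ s in Ioi (0 : ℝ), s ^ (-(1 / 2) : ℝ) * exp (-(c * (s + s⁻¹))) := by
  rw [← integral_comp_rpow_Ioi (fun s : ℝ => s ^ (-(1 / 2) : ℝ) * exp (-(c * (s + s⁻¹))))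
    (by norm_num : (-1 : ℝ) ≠ 0)]
  refine setIntegral_congr_fun measurableSet_Ioi fun s hs => ?_
  have hs0 : 0 < s := hs
  simp only [smul_eq_mul]
  rw [← rpow_mul hs0.le, rpow_neg_one, inv_inv, abs_neg, abs_one, one_mul, ← mul_assoc,
    ← rpow_add hs0, add_comm s⁻¹]
  norm_num

theorem integral_rpow_mul_exp_inversion {c : ℝ} (hc : 0 < c) :
    ∫ t in Ioi (0 : ℝ), t ^ (-(1 / 2) : ℝ) * exp (-(t + c ^ 2 / t)) =
      c * ∫ t in Ioi (0 : ℝ), t ^ (-(3 / 2) : ℝ) * exp (-(t + c ^ 2 / t)) := by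
  have key : ∀ p : ℝ, ∫ t in Ioi (0 : ℝ), t ^ p * exp (-(t + c ^ 2 / t)) =
      c * c ^ p * ∫ s in Ioi (0 : ℝ), s ^ p * exp (-(c * (s + s⁻¹))) := fun p => by
    have h := integral_comp_mul_left_Ioi (fun t : ℝ => t ^ p * exp (-(t + c ^ 2 / t))) 0 hc
    rw [mul_zero, smul_eq_mul] at h
    rw [mul_assoc, ← integral_const_mul, ← mul_inv_cancel_left₀ hc.ne' (∫ t in Ioi (0 : ℝ), _), ← h]
    congr 1
    refine setIntegral_congr_fun measurableSet_Ioi fun s hs => ?_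
    have hs0 : 0 < s := hs
    rw [mul_rpow hc.le hs0.le, mul_assoc]
    congr 4
    field_simp
  rw [key, key, integral_inversion_Ioi, show (-(1 / 2) : ℝ) = 1 + -(3 / 2) by norm_num,
    rpow_add hc, rpow_one]
  ring

/-- Shape `(n + 1) / 2` makes the power of `t` in the mixture exactly `t ^ (-1 / 2)`, where the
inversion symmetry applies with `c = π * ‖ξ‖`. The extra factor `‖ξ‖` converts the nonsmooth symbol
`|ξ|` into `|ξ|²`. -/
theorem gaussMix_eq_norm_mul {n : ℕ} {ξ : Rn n} (hξ : ξ ≠ 0) :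
    gaussMix (((n : ℝ) + 1) / 2) 1 ξ =
      π * ‖ξ‖ * ∫ t, t ^ (-1 : ℝ) * gaussKer t ξ ∂gammaMeasure (((n : ℝ) + 1) / 2) 1 := by
  have hc : 0 < π * ‖ξ‖ := mul_pos pi_pos (norm_pos_iff.2 hξ)
  have ha : 0 < ((n : ℝ) + 1) / 2 := by positivity
  have key : ∀ p t : ℝ, 0 < t → t ^ (((n : ℝ) + 1) / 2 - 1) * exp (-(1 * t)) *
      (t ^ p * gaussKer t ξ) =
      π ^ ((n : ℝ) / 2) * (t ^ (p - 1 / 2) * exp (-(t + (π * ‖ξ‖) ^ 2 / t))) := fun p t ht => by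
    rw [gaussKer, div_rpow pi_pos.le ht.le,
      show -(t + (π * ‖ξ‖) ^ 2 / t) = -(1 * t) + -(π ^ 2 / t) * ‖ξ‖ ^ 2 by ring, exp_add,
      show p - 1 / 2 = (((n : ℝ) + 1) / 2 - 1) + p + -((n : ℝ) / 2) by ring, rpow_add ht,
      rpow_add ht, rpow_neg ht.le ((n : ℝ) / 2)]
    ring
  have h1 := integral_gammaMeasure ha one_pos fun t => t ^ (0 : ℝ) * gaussKer t ξ
  rw [setIntegral_congr_fun measurableSet_Ioi (key 0), integral_const_mul] at h1
  have h2 := integral_gammaMeasure ha one_pos fun t => t ^ (-1 : ℝ) * gaussKer t ξ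
  rw [setIntegral_congr_fun measurableSet_Ioi (key (-1)), integral_const_mul] at h2
  have e : gaussMix (((n : ℝ) + 1) / 2) 1 ξ =
      ∫ t, t ^ (0 : ℝ) * gaussKer t ξ ∂gammaMeasure (((n : ℝ) + 1) / 2) 1 := by
    simp [gaussMix]
  have h := integral_rpow_mul_exp_inversion hc
  rw [e, h1, h2, zero_sub, h, show (-1 : ℝ) - 1 / 2 = -(3 / 2) by norm_num]
  ring

/-- Differentiation of the Gaussian formula in `b` under the integral; for parameters within `b / 2`
of `b` the derivative is dominated by the Gaussian with rate `b / 2`. -/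
theorem fourierInv_norm_sq_mul_exp {n : ℕ} (hn : 1 ≤ n) {b : ℝ} (hb : 0 < b) (x : Rn n) :
    𝓕⁻ (fun ξ : Rn n => ((‖ξ‖ ^ 2 * exp (-b * ‖ξ‖ ^ 2) : ℝ) : ℂ)) x =
      (((π / b) ^ ((n : ℝ) / 2) * exp (-(π ^ 2 * ‖x‖ ^ 2 / b)) *
        ((n : ℝ) / 2 / b - π ^ 2 * ‖x‖ ^ 2 / b ^ 2) : ℝ) : ℂ) := by
  have hc : Continuous fun ξ : Rn n => Real.fourierChar (inner ℝ ξ x) :=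
    Real.continuous_fourierChar.comp (by fun_prop)
  have hint : Integrable fun ξ : Rn n => ‖ξ‖ ^ 2 * exp (-(b / 2) * ‖ξ‖ ^ 2) := by
    simpa using integrable_norm_rpow_mul_exp hn (half_pos hb) zero_le_two
  have hint0 : Integrable fun ξ : Rn n => exp (-b * ‖ξ‖ ^ 2) := by
    simpa using integrable_norm_rpow_mul_exp hn hb le_rfl
  have hd := (hasDerivAt_integral_of_dominated_loc_of_deriv_le (μ := (volume : Measure (Rn n)))
    (F := fun b ξ => Real.fourierChar (inner ℝ ξ x) • ((exp (-b * ‖ξ‖ ^ 2) : ℝ) : ℂ))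
    (F' := fun b ξ => Real.fourierChar (inner ℝ ξ x) •
      (-((‖ξ‖ ^ 2 * exp (-b * ‖ξ‖ ^ 2) : ℝ) : ℂ)))
    (x₀ := b) (bound := fun ξ => ‖ξ‖ ^ 2 * exp (-(b / 2) * ‖ξ‖ ^ 2))
    (Metric.ball_mem_nhds b (half_pos hb))
    (.of_forall fun c => Continuous.aestronglyMeasurable (hc.smul (by fun_prop))) ?_
    (Continuous.aestronglyMeasurable (hc.smul (by fun_prop))) ?_ hint ?_).2
  · have hv : HasDerivAt (fun b : ℝ => (((π / b) ^ ((n : ℝ) / 2) *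
        exp (-(π ^ 2 * ‖x‖ ^ 2 / b)) : ℝ) : ℂ))
        ((-((π / b) ^ ((n : ℝ) / 2) * exp (-(π ^ 2 * ‖x‖ ^ 2 / b)) *
          ((n : ℝ) / 2 / b - π ^ 2 * ‖x‖ ^ 2 / b ^ 2)) : ℝ) : ℂ) b := by
      refine HasDerivAt.ofReal_comp ?_
      have i1 : HasDerivAt (fun b : ℝ => π / b) (-(π / b ^ 2)) b := by
        simpa [div_eq_mul_inv] using (hasDerivAt_inv hb.ne').const_mul π
      have i2 : HasDerivAt (fun b : ℝ => -(π ^ 2 * ‖x‖ ^ 2 / b)) (π ^ 2 * ‖x‖ ^ 2 / b ^ 2) b := by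
        simpa [div_eq_mul_inv] using ((hasDerivAt_inv hb.ne').const_mul (π ^ 2 * ‖x‖ ^ 2)).fun_neg
      have hpb : 0 < π / b := by positivity
      refine ((i1.rpow_const (p := (n : ℝ) / 2) (Or.inl hpb.ne')).mul i2.exp).congr_deriv ?_
      rw [rpow_sub_one hpb.ne']
      field_simp
      ring
    have he : (fun b : ℝ => ∫ ξ : Rn n, Real.fourierChar (inner ℝ ξ x) •
        ((exp (-b * ‖ξ‖ ^ 2) : ℝ) : ℂ)) =ᶠ[nhds b] fun b : ℝ => (((π / b) ^ ((n : ℝ) / 2) *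
        exp (-(π ^ 2 * ‖x‖ ^ 2 / b)) : ℝ) : ℂ) := by
      filter_upwards [lt_mem_nhds hb] with c hc
      rw [← fourierInv_exp_neg_mul_sq hc, Real.fourierInv_eq]
    have hu := (hv.congr_of_eventuallyEq he).unique hd
    simp_rw [smul_neg] at hu
    rw [integral_neg, Complex.ofReal_neg, neg_inj] at hu
    rw [Real.fourierInv_eq, hu]
  · have hint1 : Integrable fun ξ : Rn n => ((exp (-b * ‖ξ‖ ^ 2) : ℝ) : ℂ) := hint0.ofReal
    exact hint1.mono (Continuous.aestronglyMeasurable (hc.smul (by fun_prop)))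
      (.of_forall fun ξ => by simp)
  · refine .of_forall fun ξ c hc => ?_
    rw [Circle.norm_smul, norm_neg, Complex.norm_real, norm_of_nonneg (by positivity)]
    gcongr
    rw [Metric.mem_ball, dist_eq, abs_lt] at hc
    linarith [hc.1]
  · refine .of_forall fun ξ c hc => ?_
    have h1 : HasDerivAt (fun c : ℝ => ((exp (-c * ‖ξ‖ ^ 2) : ℝ) : ℂ))
        (-((‖ξ‖ ^ 2 * exp (-c * ‖ξ‖ ^ 2) : ℝ) : ℂ)) c := by
      rw [← Complex.ofReal_neg]
      refine HasDerivAt.ofReal_comp ?_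
      refine (((hasDerivAt_id c).neg.mul_const (‖ξ‖ ^ 2)).exp).congr_deriv ?_
      simp
      ring
    simp only [Circle.smul_def, smul_eq_mul]
    exact h1.const_mul _

theorem norm_fourierInv_norm_sq_mul_gaussKer_le {n : ℕ} (hn : 1 ≤ n) {t : ℝ} (ht : 0 < t)
    (x : Rn n) :
    ‖𝓕⁻ (fun ξ : Rn n => ((‖ξ‖ ^ 2 * gaussKer t ξ : ℝ) : ℂ)) x‖ ≤
      ((n : ℝ) + 2) / (2 * π ^ 2) * (t * exp (-(‖x‖ ^ 2 / 2 * t))) := by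
  have e : (fun ξ : Rn n => ((‖ξ‖ ^ 2 * gaussKer t ξ : ℝ) : ℂ)) =
      (((π / t) ^ ((n : ℝ) / 2) : ℝ) : ℂ) • fun ξ : Rn n =>
        ((‖ξ‖ ^ 2 * exp (-(π ^ 2 / t) * ‖ξ‖ ^ 2) : ℝ) : ℂ) := by
    funext ξ
    rw [Pi.smul_apply, smul_eq_mul, ← Complex.ofReal_mul, gaussKer, mul_left_comm]
  rw [e, fourierInv_const_smul, fourierInv_norm_sq_mul_exp hn (by positivity), smul_eq_mul,
    ← Complex.ofReal_mul, Complex.norm_real, ← mul_assoc, ← mul_assoc,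
    ← mul_rpow (by positivity) (by positivity), show π / t * (π / (π ^ 2 / t)) = 1 by field_simp,
    one_rpow, one_mul, norm_mul, norm_of_nonneg (exp_pos _).le, Real.norm_eq_abs]
  set z := ‖x‖ ^ 2 * t with hz
  have hz0 : 0 ≤ z := by positivity
  -- The decay is split in two: one half absorbs the polynomial `n + 2 * z`, the other half
  -- survives.
  have h1 : π ^ 2 * ‖x‖ ^ 2 / (π ^ 2 / t) = z / 2 + z / 2 := by rw [hz]; field_simp; ring
  have h2 : (n : ℝ) / 2 / (π ^ 2 / t) - π ^ 2 * ‖x‖ ^ 2 / (π ^ 2 / t) ^ 2 =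
      t / (2 * π ^ 2) * (n - 2 * z) := by rw [hz]; field_simp
  have h3 : ‖x‖ ^ 2 / 2 * t = z / 2 := by rw [hz]; ring
  rw [h1, h2, h3, abs_mul, abs_of_pos (by positivity), neg_add, exp_add]
  have h4 : |(n : ℝ) - 2 * z| ≤ n + 2 * z := by
    have : (0 : ℝ) ≤ n := Nat.cast_nonneg n
    rw [abs_le]; constructor <;> linarith
  have h5 : exp (-(z / 2)) * (n + 2 * z) ≤ n + 2 := by
    have h6 : z * exp (-(z / 2)) ≤ 1 := by
      rw [exp_neg, ← div_eq_mul_inv, div_le_one (exp_pos _)]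
      have h7 := add_one_le_exp (z / 4)
      have h8 : exp (z / 2) = exp (z / 4) ^ 2 := by rw [← exp_nat_mul]; push_cast; ring_nf
      rw [h8]
      nlinarith [sq_nonneg (1 - z / 4)]
    have h9 : exp (-(z / 2)) ≤ 1 := by rw [exp_le_one_iff]; linarith
    have : (0 : ℝ) ≤ n := Nat.cast_nonneg n
    nlinarith
  calc exp (-(z / 2)) * exp (-(z / 2)) * (t / (2 * π ^ 2) * |(n : ℝ) - 2 * z|)
      ≤ exp (-(z / 2)) * exp (-(z / 2)) * (t / (2 * π ^ 2) * (n + 2 * z)) := by gcongr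
    _ = (exp (-(z / 2)) * (n + 2 * z)) * (t / (2 * π ^ 2) * exp (-(z / 2))) := by ring
    _ ≤ (n + 2) * (t / (2 * π ^ 2) * exp (-(z / 2))) := by gcongr
    _ = _ := by ring

/-- The factor `t` in the Gaussian estimate cancels the `t ^ (-1)` of the mixture, so the Laplace
transform of the Gamma law at `‖x‖ ^ 2 / 2` remains. -/
theorem norm_sqrtOp_zero_weight_le {n : ℕ} (hn : 1 ≤ n) (x : Rn n) :
    ‖sqrtOp 0 (weight n ((n : ℝ) + 1) 1) x‖ ≤
      (n + 2) * (1 + ‖x‖ ^ 2 / 2) ^ (-(((n : ℝ) + 1) / 2)) := by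
  have ha : 0 < ((n : ℝ) + 1) / 2 := by positivity
  have hq : (n : ℝ) / 2 < n + 1 := by linarith [(Nat.cast_nonneg n : (0 : ℝ) ≤ n)]
  have := isProbabilityMeasure_gammaMeasure ha one_pos
  set μ := gammaMeasure (((n : ℝ) + 1) / 2) 1 with hμ
  let k : ℝ → Rn n → ℂ := fun t ξ => ((t ^ (-1 : ℝ) * (‖ξ‖ ^ (2 : ℝ) * gaussKer t ξ) : ℝ) : ℂ)
  have hk : Integrable (Function.uncurry k) (μ.prod volume) :=
    (integrable_prod_rpow_mul_gaussKer hn ha one_pos zero_le_two (by linarith)).ofReal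
  have h1 : multiplied (symb 0) (weight n ((n : ℝ) + 1) 1) =ᵐ[volume]
      (((2 * π ^ 2 : ℝ) : ℂ) • fun ξ => ∫ t, k t ξ ∂μ) := by
    filter_upwards [multiplied_weight hn hq one_pos 0] with ξ hξ
    rw [hξ, Pi.smul_apply, smul_eq_mul, integral_complex_ofReal, ← Complex.ofReal_mul]
    congr 1
    have hs : symb 0 ((2 * π) • ξ) = 2 * π * ‖ξ‖ := by
      rw [symb, norm_smul, norm_of_nonneg two_pi_pos.le, zero_pow two_ne_zero, zero_add,
        sqrt_sq (by positivity)]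
    have hm : ∫ t, t ^ (-1 : ℝ) * (‖ξ‖ ^ (2 : ℝ) * gaussKer t ξ) ∂μ =
        ‖ξ‖ ^ 2 * ∫ t, t ^ (-1 : ℝ) * gaussKer t ξ ∂μ := by
      rw [← integral_const_mul]
      congr 1
      funext t
      rw [rpow_two]; ring
    rw [hs, hm]
    -- `gaussMix_eq_norm_mul` excludes the origin, but there both sides carry a vanishing factor
    -- `‖ξ‖`.
    rcases eq_or_ne ξ 0 with rfl | h0
    · simp
    · rw [one_pow, gaussMix_eq_norm_mul h0]; ring
  rw [sqrtOp, multiplier, Real.fourierInv_congr_ae h1, fourierInv_const_smul,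
    fourierInv_integral hk, norm_smul, Complex.norm_real, norm_of_nonneg (by positivity)]
  have h2 : ‖∫ t, 𝓕⁻ (k t) x ∂μ‖ ≤
      ∫ t, ((n : ℝ) + 2) / (2 * π ^ 2) * exp (-(‖x‖ ^ 2 / 2 * t)) ∂μ := by
    refine norm_integral_le_of_norm_le
      ((integrable_exp_gammaMeasure ha one_pos (by positivity)).const_mul _) ?_
    filter_upwards [gammaMeasure_ae_pos (((n : ℝ) + 1) / 2) 1] with t ht
    have e : k t = ((t ^ (-1 : ℝ) : ℝ) : ℂ) •
        fun ξ : Rn n => ((‖ξ‖ ^ 2 * gaussKer t ξ : ℝ) : ℂ) := by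
      funext ξ
      simp only [k]
      rw [Pi.smul_apply, smul_eq_mul, ← Complex.ofReal_mul, rpow_two]
    rw [e, fourierInv_const_smul, norm_smul, Complex.norm_real, norm_of_nonneg (by positivity)]
    refine (mul_le_mul_of_nonneg_left (norm_fourierInv_norm_sq_mul_gaussKer_le hn ht x)
      (by positivity)).trans_eq ?_
    rw [rpow_neg_one]
    field_simp
  refine (mul_le_mul_of_nonneg_left h2 (by positivity)).trans_eq ?_
  rw [integral_const_mul, integral_exp_gammaMeasure ha one_pos (by positivity), div_one]
  field_simp

theorem masslessBound {n : ℕ} (hn : 1 ≤ n) :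
    MasslessBound n ((n + 2) * 2 ^ (((n : ℝ) + 1) / 2)) := by
  intro x
  refine (norm_sqrtOp_zero_weight_le hn x).trans ?_
  rw [jap_rpow_neg, mul_assoc]
  refine mul_le_mul_of_nonneg_left ?_ (by positivity)
  have h : (2 : ℝ) ^ (((n : ℝ) + 1) / 2) = (2⁻¹ : ℝ) ^ (-(((n : ℝ) + 1) / 2)) := by
    rw [inv_rpow zero_le_two, rpow_neg zero_le_two, inv_inv]
  rw [h, ← mul_rpow (by norm_num) (by positivity)]
  refine rpow_le_rpow_of_nonpos (by positivity) ?_ (by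
    have : (0 : ℝ) ≤ n := Nat.cast_nonneg n
    linarith)
  linarith

/-! ### The estimates for an arbitrary Bessel kernel and scale -/

theorem IsBesselKernel.weightedNorm_eq {n : ℕ} (hn : 1 ≤ n) {K : Rn n → ℝ}
    (hK : IsBesselKernel K) (q : ℝ) : weightedNorm q K = weightedNorm q (besselKer : Rn n → ℝ) := by
  refine integral_congr_ae ?_
  filter_upwards [hK.ae_eq (isBesselKernel_besselKer hn)] with y hy
  rw [hy]

theorem IsBesselKernel.integrable_jap_rpow_mul {n : ℕ} (hn : 1 ≤ n) {K : Rn n → ℝ}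
    (hK : IsBesselKernel K) {q : ℝ} (hq : 0 ≤ q) : Integrable fun y => jap y ^ q * K y := by
  refine (integrable_jap_rpow_mul_besselKer hn hq).congr ?_
  filter_upwards [hK.ae_eq (isBesselKernel_besselKer hn)] with y hy
  rw [hy]

theorem IsBesselKernel.norm_sqrtOp_weight_le {n : ℕ} (hn : 1 ≤ n) {K : Rn n → ℝ}
    (hK : IsBesselKernel K) {q : ℝ} (hq : (n : ℝ) / 2 < q) (m : ℝ) (x : Rn n) :
    ‖sqrtOp m (weight n q 1) x‖ ≤ ‖sqrtOp 0 (weight n q 1) x‖ +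
      (2 : ℝ) ^ (q / 2) * weightedNorm q K * jap m ^ (q + 1) * jap x ^ (-q) := by
  refine (MassiveWeight.norm_sqrtOp_weight_le hn hq m x).trans ?_
  have h : 0 ≤ jap x ^ (-q) := rpow_nonneg (sqrt_nonneg _) _
  rw [hK.weightedNorm_eq hn]
  have := mul_le_mul_of_nonneg_right (sqrt_le_two_rpow_mul_weightedNorm hn hq m) h
  linarith

theorem norm_sqrtOp_weight_scaled_le {n : ℕ} (hn : 1 ≤ n) {K : Rn n → ℝ}
    (hK : IsBesselKernel K) {A : ℝ} (hA : MasslessBound n A) (m : ℝ) {R : ℝ} (hR : 0 < R)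
    (x : Rn n) :
    ‖sqrtOp m (weight n ((n : ℝ) + 1) R) x‖ ≤
      R⁻¹ * (A + (2 : ℝ) ^ (((n : ℝ) + 1) / 2) * weightedNorm ((n : ℝ) + 1) K) *
        jap (R * m) ^ ((n : ℝ) + 2) * jap (R⁻¹ • x) ^ (-((n : ℝ) + 1)) := by
  have hn0 : (0 : ℝ) ≤ n := Nat.cast_nonneg n
  have hq : (n : ℝ) / 2 < n + 1 := by linarith
  rw [sqrtOp_weight_scaling hn hq hR, norm_mul, Complex.norm_real, norm_of_nonneg (by positivity),
    mul_assoc, mul_assoc]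
  refine mul_le_mul_of_nonneg_left ?_ (by positivity)
  have h := hK.norm_sqrtOp_weight_le hn hq (R * m) (R⁻¹ • x)
  have h1 := hA (R⁻¹ • x)
  rw [add_assoc, one_add_one_eq_two] at h
  have hx : 0 < jap (R⁻¹ • x) ^ (-((n : ℝ) + 1)) :=
    rpow_pos_of_pos (one_pos.trans_le (one_le_jap _)) _
  -- Any admissible `A` is nonnegative, so the massless term may be multiplied by the factor `jap (R
  -- * m) ^ (n + 2) ≥ 1`.
  have hA0 : 0 ≤ A := nonneg_of_mul_nonneg_left ((norm_nonneg _).trans h1) hx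
  have hj : 1 ≤ jap (R * m) ^ ((n : ℝ) + 2) := one_le_rpow (one_le_jap _) (by linarith)
  have h2 : A * jap (R⁻¹ • x) ^ (-((n : ℝ) + 1)) ≤
      A * jap (R⁻¹ • x) ^ (-((n : ℝ) + 1)) * jap (R * m) ^ ((n : ℝ) + 2) :=
    le_mul_of_one_le_right (mul_nonneg hA0 hx.le) hj
  linarith

end MassiveWeight

theorem proposition1p8 (n : ℕ) (hn : 1 ≤ n) :
    (∃ K : MassiveWeight.Rn n → ℝ, MassiveWeight.IsBesselKernel K) ∧
    (∃ A : ℝ, 0 < A ∧ MassiveWeight.MasslessBound n A) ∧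
    ∀ K : MassiveWeight.Rn n → ℝ, MassiveWeight.IsBesselKernel K →
      (∀ q : ℝ, (n : ℝ) / 2 < q →
        Integrable (fun y => MassiveWeight.jap y ^ q * K y) ∧
        ∀ m : ℝ,
          MassiveWeight.MultiplierDefined (MassiveWeight.symb m) (MassiveWeight.weight n q 1) ∧
          ∀ x : MassiveWeight.Rn n,
            ‖MassiveWeight.sqrtOp m (MassiveWeight.weight n q 1) x‖ ≤
              ‖MassiveWeight.sqrtOp 0 (MassiveWeight.weight n q 1) x‖ +
                (2 : ℝ) ^ (q / 2) * MassiveWeight.weightedNorm q K *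
                  MassiveWeight.jap m ^ (q + 1) * MassiveWeight.jap x ^ (-q)) ∧
      (∀ A : ℝ, MassiveWeight.MasslessBound n A →
        ∀ m R : ℝ, 0 < R →
          MassiveWeight.MultiplierDefined (MassiveWeight.symb m)
            (MassiveWeight.weight n ((n : ℝ) + 1) R) ∧
          ∀ x : MassiveWeight.Rn n,
            ‖MassiveWeight.sqrtOp m (MassiveWeight.weight n ((n : ℝ) + 1) R) x‖ ≤
              R⁻¹ *
                (A + (2 : ℝ) ^ (((n : ℝ) + 1) / 2) *
                  MassiveWeight.weightedNorm ((n : ℝ) + 1) K) *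
                MassiveWeight.jap (R * m) ^ ((n : ℝ) + 2) *
                MassiveWeight.jap (R⁻¹ • x) ^ (-((n : ℝ) + 1))) := by
  have hn0 : (0 : ℝ) ≤ n := Nat.cast_nonneg n
  refine ⟨⟨_, MassiveWeight.isBesselKernel_besselKer hn⟩,
    ⟨_, by positivity, MassiveWeight.masslessBound hn⟩, fun K hK => ⟨fun q hq =>
      ⟨hK.integrable_jap_rpow_mul hn (by linarith), fun m =>
        ⟨MassiveWeight.multiplierDefined_weight hn hq one_pos m,
          hK.norm_sqrtOp_weight_le hn hq m⟩⟩,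
      fun A hA m R hR => ⟨MassiveWeight.multiplierDefined_weight hn (by linarith) hR m,
        MassiveWeight.norm_sqrtOp_weight_scaled_le hn hK hA m hR⟩⟩⟩
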